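/- **Setting.** A metric graph $\Gamma=(E,V,l,i,j)$ has edge lengths with $0<l_-\le l(e)\le l_+<\infty$ for all $e\in E$; loops and multiple edges are allowed, and $e$ is identified with $I_e=(0,l(e))$. With the path metric on $X_\Gamma=V\cup\bigcup_e\{e\}\times I_e$, let $E(v,r)$ be the set of edges that meet the open ball $B_r(v)$, and let $\Lambda_r(v)$ be the subgraph induced by $E(v,r)$. The graph has uniform polynomial growth of degree $d\in\mathbb R$ with constant $c_p$, that is, $\sum_{e\in E(v,r)}l(e)\le c_p r^d$ for all $v\in V$ and $r\ge l_-$. A vertex condition $(P,L)$ consists, for each $v\in V$, of an orthogonal projection $P_v$ on $\ell^2(E_v)$, where $E_v$ is the set of edge ends at $v$, and of a self-adjoint operator $L_v$ in $\operatorname{Ran}(1-P_v)$, the $L_v$ having a common lower bound $-S$. The random potential is $V_\omega=(\omega_e\nu_e)_{e\in E}$, $\omega\in\Omega=[q_-,q_+]^E$, $q_-<q_+$, where $0<c_-\le\nu_e\le c_+$ a.e. on $I_e$ with $\nu_e$ measurable, and the coupling constants $\omega_e$ are distributed by a probability measure on $\mathbb R$ with support $[q_-,q_+]$ and bounded density.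 Put $C_V=\max\{|q_-|,|q_+|\}\,c_+$. The restriction $H^{\Lambda_r(v)}(\omega)$ is the operator $f\mapsto -f''+V_\omega f$ in $\bigoplus_{e\in E(v,r)}L^2(I_e)$. Its domain consists of those $f\in\bigoplus_{e\in E(v,r)}W^{2,2}(I_e)$ for which, at each vertex $w$ all of whose incident edges are in $E(v,r)$, the vector $\operatorname{tr}_w f$ of boundary values of $f$ is in $\operatorname{dom}L_w$ and $L_w\operatorname{tr}_w f=(1-P_w)\operatorname{str}_w f'$, where $\operatorname{str}_w f'$ is the vector of the derivatives of $f$ pointing into the edges, and for which the boundary values of $f$ vanish at each vertex that is incident both with an edge in $E(v,r)$ and with an edge not in $E(v,r)$. Let $n_H(\lambda)=\operatorname{Tr}\mathbf 1_{(-\infty,\lambda]}(H)$ be the spectral counting function. **Corollary (Weyl bound).** For all $\omega\in\Omega$, $v\in V$, $r\ge l_-$ and $\lambda\in\mathbb R$, $$ n_{H^{\Lambda_r(v)}(\omega)}(\lambda)\le \begin{cases} \Bigl(2+\dfrac{\bigl(\sqrt{\max\{\lambda,0\}}+\sqrt{C_V}\bigr)\,l_+}{\pi}\Bigr)\dfrac{c_p\,r^d}{l_-},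 & \lambda\ge -C_V,\\[2ex] \dfrac{2\,c_p\,r^d}{l_-}, & \lambda<-C_V. \end{cases} $$ Thus for each bounded interval $I$ there is a constant $C_{\mathrm{Weyl}}$, depending only on $l_-,l_+,C_V,c_p$ and $I$, such that $n_{H^{\Lambda_r(v)}(\omega)}(\lambda)\le C_{\mathrm{Weyl}}\,r^d$ for all $\lambda\in I$, all $r\ge l_-$, all $v\in V$ and all $\omega\in\Omega$ (and for all graphs, vertex conditions and potentials as above with these $l_-,l_+,c_p,C_V$). -/

import Mathlib

open Set Filter Topology MeasureTheory
open scoped ENNReal NNReal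

noncomputable section

namespace QGraph

/-! ### Metric graphs -/

/-- The two ends of an edge `(0, l)`: `start` is the end `0`, `finish` is the end `l`. -/
inductive Side : Type
  | start : Side
  | finish : Side

/-- A metric graph all of whose edges have finite length. Loops and multiple edges are allowed;
the edge `e` is identified with the interval `(0, len e)`. -/
structure MetricGraph (E V : Type*) where
  len : E → ℝ
  len_pos : ∀ e, 0 < len e
  init : E → V
  term : E → V

namespace MetricGraph

variable {E V : Type*} (Γ : MetricGraph E V)

/-- The vertex at a given end of an edge. -/
def endVertex (p : E × Side) : V :=
  match p.2 with
  | Side.start => Γ.init p.1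
  | Side.finish => Γ.term p.1

/-- The set `E_v` of all edge ends at the vertex `v` (a loop at `v` contributes two of them). -/
abbrev Ends (v : V) : Type _ := {p : E × Side // Γ.endVertex p = v}

/-- The points of the metric space `X_Γ`: the vertices and the points `(e, t)`, `0 < t < len e`. -/
inductive Point
  | vertex (v : V) : Point
  | edge (e : E) (t : Ioo (0 : ℝ) (Γ.len e)) : Point

variable {Γ} in
/-- `x.IsAt e s`: the point `x` has the parameter `s ∈ [0, len e]` on the closed edge `e`. -/
inductive Point.IsAt : Γ.Point → E → ℝ → Prop
  | interior (e : E) (t : Ioo (0 : ℝ) (Γ.len e)) : Point.IsAt (Point.edge e t) e t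
  | start (e : E) : Point.IsAt (Point.vertex (Γ.init e)) e 0
  | finish (e : E) : Point.IsAt (Point.vertex (Γ.term e)) e (Γ.len e)

variable {Γ} in
/-- `HasPath x y L`: there is a path of length `L` from `x` to `y`, composed of finitely many
segments each of which lies in one closed edge. -/
inductive HasPath : Γ.Point → Γ.Point → ℝ≥0∞ → Prop
  | refl (x : Γ.Point) : HasPath x x 0
  | cons {x y z : Γ.Point} {e : E} {s t : ℝ} {L : ℝ≥0∞} (hx : x.IsAt e s) (hy : y.IsAt e t)
      (h : HasPath y z L) : HasPath x z (ENNReal.ofReal |s - t| + L)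

/-- The path metric `ϱ(x, y) = inf {|p| : p a path from x to y}`
(infinite between different components). -/
def pathDist (x y : Γ.Point) : ℝ≥0∞ := sInf {L | HasPath x y L}

/-- The edge set `E(v, r)` of the ball `Λ_r(v)`: all edges that meet the open metric ball
`B_r(v)`. -/
def ballEdges (v : V) (r : ℝ) : Set E :=
  {e | ∃ t : Ioo (0 : ℝ) (Γ.len e),
    Γ.pathDist (Point.vertex v) (Point.edge e t) < ENNReal.ofReal r}

/-- The volume of the subgraph induced by `E₁`: the sum of the lengths of its edges. -/
def vol (E₁ : Set E) : ℝ≥0∞ := ∑' e : E₁, ENNReal.ofReal (Γ.len e)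

/-- The edge lengths are uniformly bounded: `0 < lmin ≤ len e ≤ lmax`. -/
def EdgeLengthsIn (lmin lmax : ℝ) : Prop :=
  0 < lmin ∧ lmin ≤ lmax ∧ ∀ e, lmin ≤ Γ.len e ∧ Γ.len e ≤ lmax

/-- Uniform polynomial growth of degree `d` with constant `cp`: `vol (Λ_r(v)) ≤ cp * r ^ d` for
all vertices `v` and all `r ≥ lmin` (the volume being finite). -/
def PolyGrowth (lmin cp d : ℝ) : Prop :=
  ∀ (v : V) (r : ℝ), lmin ≤ r →
    Γ.vol (Γ.ballEdges v r) ≠ ∞ ∧ (Γ.vol (Γ.ballEdges v r)).toReal ≤ cp * r ^ d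

/-- The inner vertices of the subgraph induced by `E₁`: all incident edges are in `E₁`. -/
def IsInner (E₁ : Set E) (v : V) : Prop :=
  ∀ p : Γ.Ends v, p.1.1 ∈ E₁

/-- The boundary vertices of the subgraph induced by `E₁`: some incident edge is in `E₁`, and
some incident edge is not. -/
def IsBoundary (E₁ : Set E) (v : V) : Prop :=
  (∃ p : Γ.Ends v, p.1.1 ∈ E₁) ∧ ∃ p : Γ.Ends v, p.1.1 ∉ E₁

/-- The space `ℓ²(E_v)` of boundary values at the vertex `v`. -/
abbrev EndSpace (v : V) : Type _ := lp (fun _ : Γ.Ends v => ℂ) 2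

end MetricGraph

/-! ### Sobolev functions on an edge -/

/-- Lebesgue measure on the interval `(0, l)`. -/
def edgeMeasure (l : ℝ) : Measure ℝ := volume.restrict (Ioo 0 l)

/-- `g` is the weak derivative of `f` on `(0, l)`. As `f` and `g` are in `L²(0, l)`, this says
that `f ∈ W^{1,2}(0, l)` with derivative `g`. -/
def HasWeakDeriv (l : ℝ) (f g : Lp ℂ 2 (edgeMeasure l)) : Prop :=
  ∀ φ : ℝ → ℝ, ContDiff ℝ ((⊤ : ℕ∞) : WithTop ℕ∞) φ → HasCompactSupport φ → tsupport φ ⊆ Ioo 0 l →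
    ∫ t, deriv φ t • f t ∂(edgeMeasure l) = -∫ t, φ t • g t ∂(edgeMeasure l)

/-- `f` has a continuous representative on `(0, l)`, and this has the limit `a` at the given end
of the interval. -/
def HasBoundaryValue (l : ℝ) (f : Lp ℂ 2 (edgeMeasure l)) (s : Side) (a : ℂ) : Prop :=
  ∃ F : ℝ → ℂ, ContinuousOn F (Ioo 0 l) ∧ f =ᵐ[edgeMeasure l] F ∧
    match s with
    | Side.start => Tendsto F (𝓝[>] 0) (𝓝 a)
    | Side.finish => Tendsto F (𝓝[<] l) (𝓝 a)

/-- The sign of an edge end in the signed trace: `+1` at `0` and `-1` at `l`. -/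
def Side.sgn : Side → ℂ
  | Side.start => 1
  | Side.finish => -1

instance (l : ℝ) : IsFiniteMeasure (edgeMeasure l) := by
  unfold edgeMeasure
  infer_instance

lemma integrable_edge {l : ℝ} (f : Lp ℂ 2 (edgeMeasure l)) : Integrable f (edgeMeasure l) :=
  (Lp.memLp f).integrable (by norm_num)

lemma integrable_smul_edge {l : ℝ} (f : Lp ℂ 2 (edgeMeasure l)) {φ : ℝ → ℝ}
    (hc : Continuous φ) (hs : HasCompactSupport φ) :
    Integrable (fun t => φ t • f t) (edgeMeasure l) := by
  obtain ⟨C, hC⟩ := hs.exists_bound_of_continuous hc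
  exact (integrable_edge f).bdd_smul C hc.aestronglyMeasurable (ae_of_all _ hC)

lemma HasWeakDeriv.zero (l : ℝ) : HasWeakDeriv l 0 0 := by
  intro φ _ _ _
  have h : ((0 : Lp ℂ 2 (edgeMeasure l)) : ℝ → ℂ) =ᵐ[edgeMeasure l] 0 := Lp.coeFn_zero _ _ _
  rw [integral_eq_zero_of_ae, integral_eq_zero_of_ae, neg_zero]
  · filter_upwards [h] with t ht
    simp only [ht, Pi.zero_apply, smul_zero]
  · filter_upwards [h] with t ht
    simp only [ht, Pi.zero_apply, smul_zero]

lemma HasWeakDeriv.add {l : ℝ} {f g f' g' : Lp ℂ 2 (edgeMeasure l)}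
    (h : HasWeakDeriv l f g) (h' : HasWeakDeriv l f' g') :
    HasWeakDeriv l (f + f') (g + g') := by
  intro φ h1 h2 h3
  have hd : Continuous (deriv φ) := h1.continuous_deriv (by simp)
  have e1 : ∫ t, deriv φ t • (f + f' : Lp ℂ 2 (edgeMeasure l)) t ∂(edgeMeasure l)
      = ∫ t, (deriv φ t • f t + deriv φ t • f' t) ∂(edgeMeasure l) := by
    apply integral_congr_ae
    filter_upwards [Lp.coeFn_add f f'] with t ht
    rw [ht, Pi.add_apply, smul_add]
  have e2 : ∫ t, φ t • (g + g' : Lp ℂ 2 (edgeMeasure l)) t ∂(edgeMeasure l)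
      = ∫ t, (φ t • g t + φ t • g' t) ∂(edgeMeasure l) := by
    apply integral_congr_ae
    filter_upwards [Lp.coeFn_add g g'] with t ht
    rw [ht, Pi.add_apply, smul_add]
  rw [e1, e2, integral_add (integrable_smul_edge f hd h2.deriv)
      (integrable_smul_edge f' hd h2.deriv),
    integral_add (integrable_smul_edge g h1.continuous h2)
      (integrable_smul_edge g' h1.continuous h2), h φ h1 h2 h3, h' φ h1 h2 h3]
  ring

lemma HasWeakDeriv.smul {l : ℝ} {f g : Lp ℂ 2 (edgeMeasure l)} (c : ℂ)
    (h : HasWeakDeriv l f g) : HasWeakDeriv l (c • f) (c • g) := by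
  intro φ h1 h2 h3
  have e1 : ∫ t, deriv φ t • (c • f : Lp ℂ 2 (edgeMeasure l)) t ∂(edgeMeasure l)
      = ∫ t, c • (deriv φ t • f t) ∂(edgeMeasure l) := by
    apply integral_congr_ae
    filter_upwards [Lp.coeFn_smul c f] with t ht
    rw [ht, Pi.smul_apply, smul_comm]
  have e2 : ∫ t, φ t • (c • g : Lp ℂ 2 (edgeMeasure l)) t ∂(edgeMeasure l)
      = ∫ t, c • (φ t • g t) ∂(edgeMeasure l) := by
    apply integral_congr_ae
    filter_upwards [Lp.coeFn_smul c g] with t ht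
    rw [ht, Pi.smul_apply, smul_comm]
  rw [e1, e2, integral_smul, integral_smul, h φ h1 h2 h3, smul_neg]

lemma HasWeakDeriv.eq_zero {l : ℝ} {g : Lp ℂ 2 (edgeMeasure l)}
    (h : HasWeakDeriv l 0 g) : g = 0 := by
  have hz : ((0 : Lp ℂ 2 (edgeMeasure l)) : ℝ → ℂ) =ᵐ[edgeMeasure l] 0 := Lp.coeFn_zero _ _ _
  have hI : IntegrableOn g (Ioo 0 l) volume := integrable_edge g
  have key := isOpen_Ioo.ae_eq_zero_of_integral_contDiff_smul_eq_zero (μ := volume)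
    (f := (g : ℝ → ℂ)) (hI.locallyIntegrableOn) (by
      intro φ h1 h2 h3
      have h4 := h φ h1 h2 h3
      rw [integral_eq_zero_of_ae (by
        filter_upwards [hz] with t ht
        simp only [ht, Pi.zero_apply, smul_zero]), eq_comm, neg_eq_zero] at h4
      unfold edgeMeasure at h4
      rw [setIntegral_eq_integral_of_forall_compl_eq_zero] at h4
      · exact h4
      · intro t ht
        rw [image_eq_zero_of_notMem_tsupport (fun hh => ht (h3 hh)), zero_smul])
  apply Lp.ext
  refine EventuallyEq.trans ?_ hz.symm
  unfold edgeMeasure at g ⊢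
  exact (ae_restrict_iff' measurableSet_Ioo).2 key

lemma HasBoundaryValue.zero (l : ℝ) (s : Side) : HasBoundaryValue l 0 s 0 := by
  refine ⟨0, continuousOn_const, Lp.coeFn_zero _ _ _, ?_⟩
  cases s <;> exact tendsto_const_nhds

lemma HasBoundaryValue.add {l : ℝ} {f g : Lp ℂ 2 (edgeMeasure l)} {s : Side} {a b : ℂ}
    (hf : HasBoundaryValue l f s a) (hg : HasBoundaryValue l g s b) :
    HasBoundaryValue l (f + g) s (a + b) := by
  obtain ⟨F, h1, h2, h3⟩ := hf
  obtain ⟨G, k1, k2, k3⟩ := hg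
  refine ⟨F + G, h1.add k1, (Lp.coeFn_add f g).trans (h2.add k2), ?_⟩
  cases s <;> exact Tendsto.add h3 k3

lemma HasBoundaryValue.smul {l : ℝ} {f : Lp ℂ 2 (edgeMeasure l)} {s : Side} {a : ℂ} (c : ℂ)
    (hf : HasBoundaryValue l f s a) : HasBoundaryValue l (c • f) s (c • a) := by
  obtain ⟨F, h1, h2, h3⟩ := hf
  refine ⟨c • F, h1.const_smul c, (Lp.coeFn_smul c f).trans (h2.const_smul c), ?_⟩
  cases s <;> exact Tendsto.const_smul h3 c

/-! ### Vertex conditions -/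

/-- A vertex condition `(P, L)`: for each vertex `v` an orthogonal projection `P_v` on `ℓ²(E_v)`
and a (possibly unbounded) self-adjoint operator `L_v` in the range of `1 - P_v` (that is, in the
kernel of `P_v`), with a common lower bound `-S`. -/
structure VertexCondition {E V : Type*} (Γ : MetricGraph E V) where
  P : ∀ v, Γ.EndSpace v →L[ℂ] Γ.EndSpace v
  isStarProjection : ∀ v, IsStarProjection (P v)
  L : ∀ v, (P v).ker →ₗ.[ℂ] (P v).ker
  isSelfAdjoint : ∀ v, IsSelfAdjoint (L v)
  bddBelow : ∃ S : ℝ, 0 < S ∧ ∀ (v : V) (x : (L v).domain),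
    -S * ‖(x : (P v).ker)‖ ^ 2 ≤ RCLike.re (inner ℂ (L v x) (x : (P v).ker))

/-- The condition at the vertex `v` on the trace `ξ` of `f` and the signed trace `η` of the
derivative of `f`: `ξ ∈ dom L_v` and `L_v ξ = (1 - P_v) η`. -/
def VertexCondition.Holds {E V : Type*} {Γ : MetricGraph E V} (B : VertexCondition Γ) (v : V)
    (ξ η : Γ.EndSpace v) : Prop :=
  ∃ z : (B.L v).domain, ((z : (B.P v).ker) : Γ.EndSpace v) = ξ ∧
    ((B.L v z : (B.P v).ker) : Γ.EndSpace v) = η - B.P v η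

lemma VertexCondition.Holds.zero {E V : Type*} {Γ : MetricGraph E V} (B : VertexCondition Γ)
    (v : V) : B.Holds v 0 0 :=
  ⟨0, by simp, by simp⟩

lemma VertexCondition.Holds.add {E V : Type*} {Γ : MetricGraph E V} {B : VertexCondition Γ}
    {v : V} {ξ η ξ' η' : Γ.EndSpace v} (h : B.Holds v ξ η) (h' : B.Holds v ξ' η') :
    B.Holds v (ξ + ξ') (η + η') := by
  obtain ⟨z, h1, h2⟩ := h
  obtain ⟨z', h1', h2'⟩ := h'
  refine ⟨z + z', by simp [h1, h1'], ?_⟩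
  rw [LinearPMap.map_add, Submodule.coe_add, h2, h2', map_add]
  abel

lemma VertexCondition.Holds.smul {E V : Type*} {Γ : MetricGraph E V} {B : VertexCondition Γ}
    {v : V} {ξ η : Γ.EndSpace v} (c : ℂ) (h : B.Holds v ξ η) :
    B.Holds v (c • ξ) (c • η) := by
  obtain ⟨z, h1, h2⟩ := h
  refine ⟨c • z, by simp [h1], ?_⟩
  rw [LinearPMap.map_smul, Submodule.coe_smul, h2, map_smul, smul_sub]

/-! ### Schroedinger operators on induced subgraphs -/

/-- The Hilbert space `L²(X_{E₁})`, the Hilbert sum of the spaces `L²(0, len e)`, `e ∈ E₁`. -/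
abbrev L2Space {E V : Type*} (Γ : MetricGraph E V) (E₁ : Set E) : Type _ :=
  lp (fun e : E₁ => Lp ℂ 2 (edgeMeasure (Γ.len e))) 2

section Operator

variable {E V : Type*} {Γ : MetricGraph E V}

/-- `f` is in the domain of the operator on the subgraph induced by `E₁` with potential `W`, and
the operator maps `f` to `h`. Here `f'` and `f''` are the first two weak derivatives of
`f ∈ W^{2,2}(X_{E₁})`; the vertex condition `B` is imposed at the inner vertices and the Dirichlet
condition at the boundary vertices, and `h = -f'' + W f`. -/
structure IsInGraph (B : VertexCondition Γ) (W : E → ℝ → ℝ) (E₁ : Set E)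
    (f f' f'' h : L2Space Γ E₁) : Prop where
  deriv₁ : ∀ e : E₁, HasWeakDeriv (Γ.len e) (f e) (f' e)
  deriv₂ : ∀ e : E₁, HasWeakDeriv (Γ.len e) (f' e) (f'' e)
  inner_cond : ∀ v, Γ.IsInner E₁ v → ∃ ξ η : Γ.EndSpace v,
    (∀ (p : Γ.Ends v) (hp : p.1.1 ∈ E₁),
      HasBoundaryValue (Γ.len p.1.1) (f ⟨p.1.1, hp⟩) p.1.2 (ξ p) ∧
      HasBoundaryValue (Γ.len p.1.1) (p.1.2.sgn • f' ⟨p.1.1, hp⟩) p.1.2 (η p)) ∧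
    B.Holds v ξ η
  boundary_cond : ∀ v, Γ.IsBoundary E₁ v → ∀ (p : Γ.Ends v) (hp : p.1.1 ∈ E₁),
    HasBoundaryValue (Γ.len p.1.1) (f ⟨p.1.1, hp⟩) p.1.2 0
  eq : ∀ e : E₁, h e =ᵐ[edgeMeasure (Γ.len e)] fun t => -(f'' e t) + (W e t : ℂ) * f e t

/-- The graph of the operator `-f'' + W f` on the subgraph induced by `E₁`. -/
def operatorGraph (B : VertexCondition Γ) (W : E → ℝ → ℝ) (E₁ : Set E) :
    Submodule ℂ (L2Space Γ E₁ × L2Space Γ E₁) where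
  carrier := {x | ∃ f' f'' : L2Space Γ E₁, IsInGraph B W E₁ x.1 f' f'' x.2}
  zero_mem' := by
    refine ⟨0, 0, ⟨fun e => HasWeakDeriv.zero _, fun e => HasWeakDeriv.zero _, fun v _ =>
      ⟨0, 0, fun p hp => ⟨HasBoundaryValue.zero _ _, ?_⟩, VertexCondition.Holds.zero B v⟩,
      fun v _ p hp => HasBoundaryValue.zero _ _, fun e => ?_⟩⟩
    · have := (HasBoundaryValue.zero (Γ.len p.1.1) p.1.2).smul p.1.2.sgn
      simpa using this
    · have h : ((0 : Lp ℂ 2 (edgeMeasure (Γ.len e))) : ℝ → ℂ) =ᵐ[edgeMeasure (Γ.len e)] 0 :=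
        Lp.coeFn_zero _ _ _
      filter_upwards [h] with t ht
      change ((0 : Lp ℂ 2 (edgeMeasure (Γ.len e))) : ℝ → ℂ) t =
        -((0 : Lp ℂ 2 (edgeMeasure (Γ.len e))) : ℝ → ℂ) t +
          (W e t : ℂ) * ((0 : Lp ℂ 2 (edgeMeasure (Γ.len e))) : ℝ → ℂ) t
      rw [ht, Pi.zero_apply, neg_zero, mul_zero, add_zero]
  add_mem' := by
    rintro ⟨f, h⟩ ⟨g, k⟩ ⟨f', f'', hf⟩ ⟨g', g'', hg⟩
    refine ⟨f' + g', f'' + g'', ⟨fun e => (hf.deriv₁ e).add (hg.deriv₁ e),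
      fun e => (hf.deriv₂ e).add (hg.deriv₂ e), fun v hv => ?_, fun v hv p hp => ?_,
      fun e => ?_⟩⟩
    · obtain ⟨ξ, η, h1, h2⟩ := hf.inner_cond v hv
      obtain ⟨ξ', η', h1', h2'⟩ := hg.inner_cond v hv
      refine ⟨ξ + ξ', η + η', fun p hp => ⟨(h1 p hp).1.add (h1' p hp).1, ?_⟩, h2.add h2'⟩
      have := (h1 p hp).2.add (h1' p hp).2
      rw [← smul_add] at this
      exact this
    · have := (hf.boundary_cond v hv p hp).add (hg.boundary_cond v hv p hp)
      rw [add_zero] at this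
      exact this
    · have a1 : (((f + g : L2Space Γ E₁) e : Lp ℂ 2 (edgeMeasure (Γ.len e))) : ℝ → ℂ)
          =ᵐ[edgeMeasure (Γ.len e)] f e + g e := Lp.coeFn_add (f e) (g e)
      have a2 : (((h + k : L2Space Γ E₁) e : Lp ℂ 2 (edgeMeasure (Γ.len e))) : ℝ → ℂ)
          =ᵐ[edgeMeasure (Γ.len e)] h e + k e := Lp.coeFn_add (h e) (k e)
      have a3 : (((f'' + g'' : L2Space Γ E₁) e : Lp ℂ 2 (edgeMeasure (Γ.len e))) : ℝ → ℂ)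
          =ᵐ[edgeMeasure (Γ.len e)] f'' e + g'' e := Lp.coeFn_add (f'' e) (g'' e)
      filter_upwards [a1, a2, a3, hf.eq e, hg.eq e] with t t1 t2 t3 t4 t5
      simp only [Prod.mk_add_mk, t1, t2, t3, Pi.add_apply]
      rw [t4, t5]
      ring
  smul_mem' := by
    rintro c ⟨f, h⟩ ⟨f', f'', hf⟩
    refine ⟨c • f', c • f'', ⟨fun e => (hf.deriv₁ e).smul c, fun e => (hf.deriv₂ e).smul c,
      fun v hv => ?_, fun v hv p hp => ?_, fun e => ?_⟩⟩
    · obtain ⟨ξ, η, h1, h2⟩ := hf.inner_cond v hv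
      refine ⟨c • ξ, c • η, fun p hp => ⟨(h1 p hp).1.smul c, ?_⟩, h2.smul c⟩
      have := (h1 p hp).2.smul c
      rw [smul_comm] at this
      exact this
    · have := (hf.boundary_cond v hv p hp).smul c
      rw [smul_zero] at this
      exact this
    · have a1 : (((c • f : L2Space Γ E₁) e : Lp ℂ 2 (edgeMeasure (Γ.len e))) : ℝ → ℂ)
          =ᵐ[edgeMeasure (Γ.len e)] c • (f e : ℝ → ℂ) := Lp.coeFn_smul c (f e)
      have a2 : (((c • h : L2Space Γ E₁) e : Lp ℂ 2 (edgeMeasure (Γ.len e))) : ℝ → ℂ)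
          =ᵐ[edgeMeasure (Γ.len e)] c • (h e : ℝ → ℂ) := Lp.coeFn_smul c (h e)
      have a3 : (((c • f'' : L2Space Γ E₁) e : Lp ℂ 2 (edgeMeasure (Γ.len e))) : ℝ → ℂ)
          =ᵐ[edgeMeasure (Γ.len e)] c • (f'' e : ℝ → ℂ) := Lp.coeFn_smul c (f'' e)
      filter_upwards [a1, a2, a3, hf.eq e] with t t1 t2 t3 t4
      simp only [Prod.smul_mk, t1, t2, t3, Pi.smul_apply, smul_eq_mul]
      rw [t4]
      ring

lemma operatorGraph_single_valued (B : VertexCondition Γ) (W : E → ℝ → ℝ) (E₁ : Set E)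
    (x : L2Space Γ E₁ × L2Space Γ E₁) (hx : x ∈ operatorGraph B W E₁) (h0 : x.1 = 0) :
    x.2 = 0 := by
  obtain ⟨f, h⟩ := x
  obtain ⟨f', f'', hf⟩ := hx
  simp only at h0 hf ⊢
  subst h0
  ext1
  funext e
  have h1 : f' e = 0 := (hf.deriv₁ e).eq_zero
  have h2 : f'' e = 0 := by
    have := hf.deriv₂ e
    rw [h1] at this
    exact this.eq_zero
  have hz : ((0 : Lp ℂ 2 (edgeMeasure (Γ.len e))) : ℝ → ℂ) =ᵐ[edgeMeasure (Γ.len e)] 0 :=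
    Lp.coeFn_zero _ _ _
  have h3 := hf.eq e
  rw [h2] at h3
  apply Lp.ext
  filter_upwards [h3, hz] with t t1 t2
  change _ = ((0 : Lp ℂ 2 (edgeMeasure (Γ.len e))) : ℝ → ℂ) t
  have t3 : (h e : ℝ → ℂ) t = -((0 : Lp ℂ 2 (edgeMeasure (Γ.len e))) : ℝ → ℂ) t +
    (W e t : ℂ) * ((0 : Lp ℂ 2 (edgeMeasure (Γ.len e))) : ℝ → ℂ) t := t1
  rw [t3, t2, Pi.zero_apply, neg_zero, mul_zero, add_zero]

/-- The operator `f ↦ -f'' + W f` in `L²(X_{E₁})` on the subgraph induced by `E₁`, with the vertex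
condition `B` at the inner vertices and the Dirichlet condition at the boundary vertices. -/
def schroedinger (B : VertexCondition Γ) (W : E → ℝ → ℝ) (E₁ : Set E) :
    L2Space Γ E₁ →ₗ.[ℂ] L2Space Γ E₁ :=
  (operatorGraph B W E₁).toLinearPMap

lemma schroedinger_graph (B : VertexCondition Γ) (W : E → ℝ → ℝ) (E₁ : Set E) :
    (schroedinger B W E₁).graph = operatorGraph B W E₁ :=
  Submodule.toLinearPMap_graph_eq _ (operatorGraph_single_valued B W E₁)

end Operator

/-! ### The random potential -/

/-- The data of the alloy-type random potential: the probability measure `μ` of the coupling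
constants, with support `[qmin, qmax]` and bounded density `ρ`, and the single site potentials
`ν_e` with `0 < cmin ≤ ν_e ≤ cmax`. -/
structure AlloyPotential {E V : Type*} (Γ : MetricGraph E V) where
  qmin : ℝ
  qmax : ℝ
  qmin_lt : qmin < qmax
  μ : Measure ℝ
  isProbabilityMeasure : IsProbabilityMeasure μ
  support_eq : μ.support = Icc qmin qmax
  ρ : ℝ → ℝ≥0∞
  measurable_ρ : Measurable ρ
  withDensity_eq : μ = volume.withDensity ρ
  bounded_ρ : ∃ c : ℝ≥0, ∀ᵐ x ∂(volume : Measure ℝ), ρ x ≤ c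
  cmin : ℝ
  cmax : ℝ
  cmin_pos : 0 < cmin
  cmin_le : cmin ≤ cmax
  ν : E → ℝ → ℝ
  aemeasurable_ν : ∀ e, AEMeasurable (ν e) (edgeMeasure (Γ.len e))
  bounds_ν : ∀ e, ∀ᵐ t ∂(edgeMeasure (Γ.len e)), cmin ≤ ν e t ∧ ν e t ≤ cmax

namespace AlloyPotential

variable {E V : Type*} {Γ : MetricGraph E V} (A : AlloyPotential Γ)

/-- The configuration space `Ω = [qmin, qmax]^E`. -/
abbrev Config : Type _ := E → Icc A.qmin A.qmax

/-- The random potential `V_ω = (ω_e ν_e)_e`. -/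
def potential (ω : A.Config) : E → ℝ → ℝ := fun e t => (ω e : ℝ) * A.ν e t

/-- The constant `C_V = max (|qmin|, |qmax|) * cmax`. -/
def bound : ℝ := max |A.qmin| |A.qmax| * A.cmax

/-- The restriction `H^{Λ_r(v)}(ω)` of the random operator to the ball `Λ_r(v)`. -/
def ballOperator (B : VertexCondition Γ) (ω : A.Config) (v : V) (r : ℝ) :
    L2Space Γ (Γ.ballEdges v r) →ₗ.[ℂ] L2Space Γ (Γ.ballEdges v r) :=
  schroedinger B (A.potential ω) (Γ.ballEdges v r)

end AlloyPotential

/-! ### The spectral counting function -/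

section Counting

variable {H : Type*} [NormedAddCommGroup H] [InnerProductSpace ℂ H]

/-- `M` is a closed subspace of the domain of `T`, invariant under `T`, on which `T ≤ lam` in the
sense of quadratic forms. -/
structure IsSpectrallyBelow (T : H →ₗ.[ℂ] H) (lam : ℝ) (M : Submodule ℂ H) : Prop where
  isClosed : IsClosed (M : Set H)
  le_domain : M ≤ T.domain
  invariant : ∀ x : T.domain, (x : H) ∈ M → T x ∈ M
  le : ∀ x : T.domain, (x : H) ∈ M → RCLike.re (inner ℂ (T x) (x : H)) ≤ lam * ‖(x : H)‖ ^ 2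

/-- The spectral subspace of `T` for `(-∞, lam]`, defined as the span of all closed invariant
subspaces on which `T ≤ lam`. For a self-adjoint operator `T` which is bounded below, the range of
the spectral projection `1_{(-∞, lam]}(T)` is the largest of these subspaces, and so is equal to
their span; if the spectrum of `T` is discrete, this is the sum of the eigenspaces for the
eigenvalues in `(-∞, lam]`. -/
def spectralSubspace (T : H →ₗ.[ℂ] H) (lam : ℝ) : Submodule ℂ H :=
  sSup {M | IsSpectrallyBelow T lam M}

/-- The spectral counting function `n_T(lam) = Tr 1_{(-∞, lam]}(T)`: the trace of a projection is
the dimension of its range. -/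
def countingFunction (T : H →ₗ.[ℂ] H) (lam : ℝ) : ℕ∞ :=
  Cardinal.toENat (Module.rank ℂ (spectralSubspace T lam))

end Counting

end QGraph

end

/-! The bound comes from counting nodes, without bracketing and without comparison operators. Let
$C$ be such that $W\ge -C$, and place $m+2$ equidistant nodes on each edge, the two ends included.
If a function $f$ in the domain vanishes at all nodes, the vertex terms in Green's formula (`green`)
disappear. Hence neither $L_v$ nor its lower bound enters, and $\langle Hf,f\rangle$ is the sum over
the edges of $\int|f'|^2+\int W|f|^2$. The Wirtinger inequality on the intervals between nodes
(`wirtinger_nodes`) bounds this below by $(\kappa^2-C)\|f\|^2$, for any $\kappa>0$ with $\kappa\,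
l(e)<(m+1)\pi$ on all edges. If moreover $\langle Hf,f\rangle\le\lambda\|f\|^2$ and
$\lambda+C<\kappa^2$, then $f=0$ (`eq_zero_of_nodal`). So the nodal values determine the elements of
any subspace of the domain on which $H\le\lambda$ as a form, and its dimension is at most $m+2$
times the number of edges (`rank_le_card_of_relation`).

The counting function is the dimension of a span of such subspaces, and a span need not inherit the
form bound. Symmetry repairs this (`countingFunction_le`): each of the subspaces is
finite-dimensional and invariant, hence spanned by eigenvectors with eigenvalues at most $\lambda$,
and on the sum of all these mutually orthogonal eigenspaces the form bound holds again. Only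
symmetry of $H$ is needed; it follows from Green's formula and the self-adjointness of the $L_v$
(`schroedinger_isFormalAdjoint`).

The choice $m=\lfloor\sqrt{\lambda+C}\,l_+/\pi\rfloor$ and the bound $c_p r^d/l_-$ for the number of
edges (`card_ballEdges_le`) give the result. The summand 2 accounts for the two ends of an edge. -/

open scoped ComplexConjugate

namespace QGraph

/-! ### Calculus on an edge -/

section Interval

/-- The primitive, vanishing at `0`, of the restriction of `g` to `(0, l)`. -/
noncomputable def primitive (l : ℝ) (g : ℝ → ℂ) (t : ℝ) : ℂ :=
  ∫ s in (0 : ℝ)..t, (Ioo 0 l).indicator g s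

variable {l : ℝ} {g : ℝ → ℂ}

lemma integrable_indicator_edge (hg : Integrable g (edgeMeasure l)) :
    Integrable ((Ioo 0 l).indicator g) volume :=
  (integrable_indicator_iff measurableSet_Ioo).2 hg

lemma continuous_primitive (hg : Integrable g (edgeMeasure l)) : Continuous (primitive l g) :=
  intervalIntegral.continuous_primitive
    (fun _ _ => (integrable_indicator_edge hg).intervalIntegrable) 0

lemma primitive_zero : primitive l g 0 = 0 := by simp [primitive]

lemma primitive_eq {t : ℝ} (ht : 0 ≤ t) :
    primitive l g t = ∫ s, (Iic t).indicator g s ∂(edgeMeasure l) := by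
  rw [primitive, intervalIntegral.integral_of_le ht, edgeMeasure,
    ← integral_indicator measurableSet_Ioc, ← integral_indicator measurableSet_Ioo]
  congr 1
  ext s
  simp only [indicator_apply, mem_Ioc, mem_Ioo, mem_Iic]
  grind

lemma edge_integral_eq {F : Type*} [NormedAddCommGroup F] [NormedSpace ℝ F] (hl : 0 ≤ l)
    (h : ℝ → F) :
    ∫ s, h s ∂(edgeMeasure l) = ∫ s in (0 : ℝ)..l, h s := by
  rw [edgeMeasure, intervalIntegral.integral_of_le hl, integral_Ioc_eq_integral_Ioo]

lemma primitive_len (hl : 0 ≤ l) : primitive l g l = ∫ s, g s ∂(edgeMeasure l) := by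
  rw [primitive_eq hl]
  apply setIntegral_congr_fun measurableSet_Ioo
  intro s hs
  simp [hs.2.le]

lemma integrable_edge_of_continuous {F : Type*} [NormedAddCommGroup F] {h : ℝ → F}
    (hh : Continuous h) : Integrable h (edgeMeasure l) :=
  (hh.continuousOn.integrableOn_compact isCompact_Icc).mono_set Ioo_subset_Icc_self

lemma integrable_mul_edge (hg : Integrable g (edgeMeasure l)) {φ : ℝ → ℂ} (hφ : Continuous φ) :
    Integrable (fun t => φ t * g t) (edgeMeasure l) := by
  obtain ⟨C, hC⟩ := (isCompact_Icc (a := (0 : ℝ)) (b := l)).exists_bound_of_continuousOn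
    hφ.continuousOn
  refine Integrable.bdd_mul (c := C) hg hφ.aestronglyMeasurable ?_
  filter_upwards [ae_restrict_mem measurableSet_Ioo] with t ht
  exact hC t (Ioo_subset_Icc_self ht)

/-- Integration by parts against the primitive of an integrable function. -/
lemma integral_mul_primitive (hl : 0 ≤ l) (hg : Integrable g (edgeMeasure l)) {φ φ' : ℝ → ℂ}
    (hφ : ∀ t, HasDerivAt φ (φ' t) t) (hφ' : Continuous φ') :
    ∫ t, φ' t * primitive l g t ∂(edgeMeasure l) =
      φ l * primitive l g l - ∫ t, φ t * g t ∂(edgeMeasure l) := by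
  have hφc : Continuous φ := continuous_iff_continuousAt.2 fun t => (hφ t).continuousAt
  -- The primitive is written as an integral, so that the left side becomes a double integral over
  -- the triangle $s\le t$, to which Fubini applies. No differentiability of the primitive is
  -- needed.
  have h1 : ∫ t, φ' t * primitive l g t ∂(edgeMeasure l) =
      ∫ t, ∫ s, {p : ℝ × ℝ | p.2 ≤ p.1}.indicator (fun p => φ' p.1 * g p.2) (t, s)
        ∂(edgeMeasure l) ∂(edgeMeasure l) := by
    apply setIntegral_congr_fun measurableSet_Ioo
    intro t ht
    simp only
    rw [primitive_eq ht.1.le, ← integral_const_mul]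
    congr 1
    ext s
    simp only [indicator_apply, mem_Iic, mem_ofPred_eq, mul_ite, mul_zero]
  have h2 : Integrable (Function.uncurry fun t s =>
      {p : ℝ × ℝ | p.2 ≤ p.1}.indicator (fun p => φ' p.1 * g p.2) (t, s))
      ((edgeMeasure l).prod (edgeMeasure l)) :=
    ((integrable_edge_of_continuous hφ').mul_prod hg).indicator
      (measurableSet_le measurable_snd measurable_fst)
  rw [h1, integral_integral_swap h2, primitive_len hl, ← integral_const_mul,
    ← integral_sub (hg.const_mul _) (integrable_mul_edge hg hφc)]
  apply setIntegral_congr_fun measurableSet_Ioo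
  intro s hs
  simp only
  have h3 : ∀ t, {p : ℝ × ℝ | p.2 ≤ p.1}.indicator (fun p => φ' p.1 * g p.2) (t, s) =
      (Ici s).indicator φ' t * g s := by
    intro t
    simp only [indicator_apply, mem_Ici, mem_ofPred_eq, ite_mul, zero_mul]
  simp only [h3]
  rw [integral_mul_const, ← sub_mul]
  congr 1
  rw [← intervalIntegral.integral_eq_sub_of_hasDerivAt (fun t _ => hφ t)
    (hφ'.intervalIntegrable s l), intervalIntegral.integral_of_le hs.2.le, edgeMeasure,
    integral_Ioc_eq_integral_Ioo, ← integral_Ico_eq_integral_Ioo (x := s),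
    ← integral_indicator measurableSet_Ico, ← integral_indicator measurableSet_Ioo]
  congr 1
  ext t
  have := hs.1
  simp only [indicator_apply, mem_Ico, mem_Ioo, mem_Ici]
  grind

/-- A locally integrable function with vanishing weak derivative on `(0, l)` is constant. -/
lemma ae_eq_const_of_integral_deriv_smul_eq_zero (hl : 0 < l) (hg : Integrable g (edgeMeasure l))
    (h : ∀ φ : ℝ → ℝ, ContDiff ℝ ((⊤ : ℕ∞) : WithTop ℕ∞) φ → HasCompactSupport φ →
      tsupport φ ⊆ Ioo 0 l → ∫ t, deriv φ t • g t ∂(edgeMeasure l) = 0) :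
    ∃ c : ℂ, g =ᵐ[edgeMeasure l] fun _ => c := by
  -- Any bump of integral 1 supported inside $(0,l)$ would do. The constant sought is the mean of
  -- $g$ against it.
  let b : ContDiffBump (l / 2) := ⟨l / 8, l / 4, by positivity, by linarith⟩
  let ρ : ℝ → ℝ := b.normed volume
  have hρ1 : ContDiff ℝ ((⊤ : ℕ∞) : WithTop ℕ∞) ρ := b.contDiff_normed
  have hρ2 : HasCompactSupport ρ := b.hasCompactSupport_normed
  have hρ3 : tsupport ρ ⊆ Ioo 0 l := by
    rw [show tsupport ρ = _ from b.tsupport_normed_eq, Real.closedBall_eq_Icc]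
    intro t ht
    simp only [b, mem_Icc] at ht
    constructor <;> linarith [ht.1, ht.2]
  have hρ4 : ∫ t, ρ t = 1 := b.integral_normed
  let c : ℂ := ∫ t, ρ t • g t ∂(edgeMeasure l)
  refine ⟨c, ?_⟩
  have hint : ∀ {φ : ℝ → ℝ}, Continuous φ → HasCompactSupport φ →
      Integrable (fun t => φ t • g t) (edgeMeasure l) := by
    intro φ h1 h2
    obtain ⟨C, hC⟩ := h2.exists_bound_of_continuous h1
    exact hg.bdd_smul C h1.aestronglyMeasurable (ae_of_all _ hC)
  have hset : ∀ {φ : ℝ → ℝ} {f : ℝ → ℂ}, tsupport φ ⊆ Ioo 0 l →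
      ∫ t, φ t • f t ∂(edgeMeasure l) = ∫ t, φ t • f t := by
    intro φ f h1
    unfold edgeMeasure
    apply setIntegral_eq_integral_of_forall_compl_eq_zero
    intro t ht
    rw [image_eq_zero_of_notMem_tsupport (fun hh => ht (h1 hh)), zero_smul]
  have key := isOpen_Ioo.ae_eq_zero_of_integral_contDiff_smul_eq_zero (μ := volume) (U := Ioo 0 l)
    (f := fun t => g t - c)
    ((show IntegrableOn (fun t => g t - c) (Ioo 0 l) volume from
      hg.sub (integrable_const c)).locallyIntegrableOn) (by
      intro φ h1 h2 h3
      set a : ℝ := ∫ t, φ t with ha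
      -- Subtracting $a\rho$ makes the integral zero, so that the primitive `Ψ` of `ψ` again has
      -- compact support in $(0,l)$ and is an admissible test function.
      let ψ : ℝ → ℝ := fun t => φ t - a * ρ t
      have hψc : ContDiff ℝ ((⊤ : ℕ∞) : WithTop ℕ∞) ψ := h1.sub (contDiff_const.mul hρ1)
      let Ψ : ℝ → ℝ := fun t => ∫ s in (0 : ℝ)..t, ψ s
      have hΨd : deriv Ψ = ψ := funext fun t => Continuous.deriv_integral ψ hψc.continuous 0 t
      have hΨ1 : ContDiff ℝ ((⊤ : ℕ∞) : WithTop ℕ∞) Ψ := by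
        refine contDiff_infty_iff_deriv.2 ⟨fun t => ?_, hΨd ▸ hψc⟩
        exact (intervalIntegral.integral_hasDerivAt_right (hψc.continuous.intervalIntegrable _ _)
          (hψc.continuous.stronglyMeasurableAtFilter _ _)
          hψc.continuous.continuousAt).differentiableAt
      have hK : IsCompact (tsupport φ ∪ tsupport ρ) := h2.isCompact.union hρ2.isCompact
      have hKne : (tsupport φ ∪ tsupport ρ).Nonempty := by
        refine Nonempty.inr ?_
        by_contra hemp
        rw [not_nonempty_iff_eq_empty, tsupport_eq_empty_iff] at hemp
        rw [hemp] at hρ4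
        simp at hρ4
      obtain ⟨x, hxK, hx⟩ := hK.exists_isLeast hKne
      obtain ⟨y, hyK, hy⟩ := hK.exists_isGreatest hKne
      have hx0 := (union_subset h3 hρ3) hxK
      have hy0 := (union_subset h3 hρ3) hyK
      have hψ0 : ∀ t, t ∉ Icc x y → ψ t = 0 := by
        intro t ht
        have h5 : t ∉ tsupport φ ∪ tsupport ρ := fun h6 => ht ⟨hx h6, hy h6⟩
        simp only [mem_union, not_or] at h5
        simp [ψ, image_eq_zero_of_notMem_tsupport h5.1, image_eq_zero_of_notMem_tsupport h5.2]
      have hψint : ∫ t, ψ t = 0 := by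
        simp only [ψ]
        rw [integral_sub (h1.continuous.integrable_of_hasCompactSupport h2)
          ((hρ1.continuous.integrable_of_hasCompactSupport hρ2).const_mul a), integral_const_mul,
          hρ4, ← ha]
        ring
      have hΨ0 : ∀ t, t ∉ Icc x y → Ψ t = 0 := by
        intro t ht
        rcases lt_or_ge t x with htx | htx
        · refine (intervalIntegral.integral_congr (g := fun _ => (0 : ℝ)) fun s hs => ?_).trans
            (by simp)
          apply hψ0
          intro h6
          have : s ≤ max 0 t := hs.2
          have : max 0 t < x := max_lt hx0.1 htx
          linarith [h6.1]
        · have hty : y < t := by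
            by_contra h7
            exact ht ⟨htx, not_lt.1 h7⟩
          -- To the right of the support, the integral from 0 to $t$ already is the full integral of
          -- `ψ`.
          rw [← hψint]
          simp only [Ψ]
          rw [intervalIntegral.integral_of_le (by linarith [hy0.1])]
          apply setIntegral_eq_integral_of_forall_compl_eq_zero
          intro s hs
          apply hψ0
          intro h6
          exact hs ⟨by linarith [h6.1, hx0.1], by linarith [h6.2]⟩
      have hts : tsupport Ψ ⊆ Icc x y :=
        closure_minimal (fun t ht => by
          by_contra h6
          exact ht (hΨ0 t h6)) isClosed_Icc
      have h8 := h Ψ hΨ1 (HasCompactSupport.of_support_subset_isCompact isCompact_Icc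
        ((subset_tsupport _).trans hts))
        (hts.trans fun t ht => ⟨hx0.1.trans_le ht.1, ht.2.trans_lt hy0.2⟩)
      rw [hΨd] at h8
      have h9 : ∫ t, ψ t • g t ∂(edgeMeasure l) =
          ∫ t, φ t • g t ∂(edgeMeasure l) - a • c := by
        simp only [c]
        rw [← integral_smul, ← integral_sub (hint h1.continuous h2)
          (show Integrable (fun t => a • ρ t • g t) (edgeMeasure l) from
            (hint hρ1.continuous hρ2).smul a)]
        congr 1
        ext t
        simp only [ψ, sub_smul, mul_smul]
      rw [← hset h3]
      have h10 : ∫ t, φ t • (g t - c) ∂(edgeMeasure l) =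
          ∫ t, φ t • g t ∂(edgeMeasure l) - ∫ t, φ t • c ∂(edgeMeasure l) := by
        rw [← integral_sub (hint h1.continuous h2)
          (show Integrable (fun t => φ t • c) (edgeMeasure l) from
            integrable_edge_of_continuous (h1.continuous.smul continuous_const))]
        congr 1
        ext t
        rw [smul_sub]
      rw [h10, hset (f := fun _ => c) h3, integral_smul_const, ← ha, ← h9, h8])
  unfold edgeMeasure
  refine (ae_restrict_iff' measurableSet_Ioo).2 ?_
  filter_upwards [key] with t ht h1
  exact sub_eq_zero.1 (ht h1)

end Interval


/-! ### Representatives of Sobolev functions -/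

section Representative

/-- `F` is a continuously differentiable representative, with derivative `G`, of the function
`f ∈ W^{2,2}(0, l)` with weak derivatives `f'` and `f''`. -/
structure IsC1Rep (l : ℝ) (f f' f'' : Lp ℂ 2 (edgeMeasure l)) (F G : ℝ → ℂ) : Prop where
  continuous : Continuous G
  hasDerivAt : ∀ t, HasDerivAt F (G t) t
  ae_eq : f =ᵐ[edgeMeasure l] F
  ae_eq' : f' =ᵐ[edgeMeasure l] G
  parts : ∀ φ φ' : ℝ → ℂ, (∀ t, HasDerivAt φ (φ' t) t) → Continuous φ' →
    ∫ t, φ t * f'' t ∂(edgeMeasure l) =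
      φ l * G l - φ 0 * G 0 - ∫ t, φ' t * G t ∂(edgeMeasure l)

variable {l : ℝ}

/-- Subtracting from $f$ the primitive of $g$ leaves a function with vanishing weak derivative: the
boundary term in the integration by parts is zero because test functions vanish at $l$. -/
lemma HasWeakDeriv.exists_ae_eq (hl : 0 < l) {f g : Lp ℂ 2 (edgeMeasure l)}
    (h : HasWeakDeriv l f g) :
    ∃ c : ℂ, f =ᵐ[edgeMeasure l] fun t => c + primitive l g t := by
  have hg := integrable_edge g
  have hP := continuous_primitive hg
  obtain ⟨c, hc⟩ := ae_eq_const_of_integral_deriv_smul_eq_zero (l := l)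
    (g := fun t => f t - primitive l g t) hl
    ((integrable_edge f).sub (integrable_edge_of_continuous hP)) (by
      intro φ h1 h2 h3
      have hd : Continuous (deriv φ) := h1.continuous_deriv (by simp)
      have hφ : ∀ t, HasDerivAt (fun t => (φ t : ℂ)) ((deriv φ t : ℝ) : ℂ) t := fun t =>
        (h1.differentiable (by simp) t).hasDerivAt.ofReal_comp
      have h4 := integral_mul_primitive hl.le hg hφ (Complex.continuous_ofReal.comp hd)
      have h5 : φ l = 0 := image_eq_zero_of_notMem_tsupport fun hh => lt_irrefl _ (h3 hh).2
      have h6 := h φ h1 h2 h3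
      have h7 : ∫ t, deriv φ t • (f t - primitive l g t) ∂(edgeMeasure l) =
          ∫ t, deriv φ t • f t ∂(edgeMeasure l) -
            ∫ t, deriv φ t • primitive l g t ∂(edgeMeasure l) := by
        rw [← integral_sub (integrable_smul_edge f hd h2.deriv)
          (show Integrable (fun t => deriv φ t • primitive l g t) (edgeMeasure l) from
            integrable_edge_of_continuous (hd.smul hP))]
        congr 1
        ext t
        rw [smul_sub]
      rw [h7, h6]
      simp only [Complex.real_smul]
      rw [h4, h5]
      simp)
  refine ⟨c, ?_⟩
  filter_upwards [hc] with t ht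
  rw [← ht]
  ring

/-- Integrating twice: $G$ is a constant plus the primitive of $f''$, and $F$ a constant plus the
integral of $G$. Both are defined on all of $\mathbb R$, so the ends of the edge need no one-sided
calculus. As $G$ need not be differentiable, $f''$ enters only through integration by parts. -/
lemma exists_isC1Rep (hl : 0 < l) {f f' f'' : Lp ℂ 2 (edgeMeasure l)}
    (h : HasWeakDeriv l f f') (h' : HasWeakDeriv l f' f'') :
    ∃ F G, IsC1Rep l f f' f'' F G := by
  obtain ⟨a, ha⟩ := h.exists_ae_eq hl
  obtain ⟨b, hb⟩ := h'.exists_ae_eq hl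
  have hf'' := integrable_edge f''
  have hP := continuous_primitive hf''
  set G : ℝ → ℂ := fun t => b + primitive l f'' t with hG
  have hGc : Continuous G := continuous_const.add hP
  refine ⟨fun t => a + ∫ s in (0 : ℝ)..t, G s, G, hGc, fun t => ?_, ?_, hb, ?_⟩
  · exact (intervalIntegral.integral_hasDerivAt_right (hGc.intervalIntegrable _ _)
      (hGc.stronglyMeasurableAtFilter _ _) hGc.continuousAt).const_add a
  · have hmem : ∀ᵐ t ∂(edgeMeasure l), t ∈ Ioo 0 l := ae_restrict_mem measurableSet_Ioo
    filter_upwards [ha, hmem] with t ht hm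
    rw [ht, primitive_eq hm.1.le, intervalIntegral.integral_of_le hm.1.le,
      integral_congr_ae (g := (Iic t).indicator G)]
    · rw [edgeMeasure, ← integral_indicator measurableSet_Ioo, ← integral_indicator measurableSet_Ioc]
      congr 2
      ext s
      have := hm.2
      simp only [indicator_apply, mem_Ioc, mem_Ioo, mem_Iic]
      by_cases h1 : 0 < s <;> by_cases h2 : s ≤ t
      · simp [h1, h2, h2.trans_lt hm.2]
      all_goals simp [h1, h2]
    · filter_upwards [hb] with s hs
      simp only [indicator_apply, hs]
  · intro φ φ' hφ hφ'
    have h1 := integral_mul_primitive hl.le hf'' hφ hφ'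
    have h2 : ∫ t, φ' t * G t ∂(edgeMeasure l) =
        (φ l - φ 0) * b + ∫ t, φ' t * primitive l f'' t ∂(edgeMeasure l) := by
      rw [← intervalIntegral.integral_eq_sub_of_hasDerivAt (fun t _ => hφ t)
        (hφ'.intervalIntegrable 0 l), ← edge_integral_eq hl.le, ← integral_mul_const,
        ← integral_add ((integrable_edge_of_continuous hφ').mul_const b)
          (show Integrable (fun t => φ' t * primitive l f'' t) (edgeMeasure l) from
            integrable_edge_of_continuous (hφ'.mul hP))]
      congr 1
      ext t
      simp only [hG]
      ring
    rw [h2, h1]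
    simp only [hG, primitive_zero]
    ring

lemma IsC1Rep.continuous_self {f f' f'' : Lp ℂ 2 (edgeMeasure l)} {F G : ℝ → ℂ}
    (h : IsC1Rep l f f' f'' F G) : Continuous F :=
  continuous_iff_continuousAt.2 fun t => (h.hasDerivAt t).continuousAt

/-- The parameter of an end of the edge `(0, l)`. -/
def Side.pos (l : ℝ) : Side → ℝ
  | Side.start => 0
  | Side.finish => l

/-- Two representatives that are continuous on the open edge agree everywhere on it, and so have the
same limits at its ends. -/
lemma HasBoundaryValue.eq_of_continuous (hl : 0 < l) {f : Lp ℂ 2 (edgeMeasure l)} {s : Side}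
    {a : ℂ} (h : HasBoundaryValue l f s a) {F : ℝ → ℂ} (hF : Continuous F)
    (hfF : f =ᵐ[edgeMeasure l] F) : a = F (s.pos l) := by
  obtain ⟨F', h1, h2, h3⟩ := h
  have heq : EqOn F' F (Ioo 0 l) :=
    Measure.eqOn_open_of_ae_eq (μ := volume) (h2.symm.trans hfF) isOpen_Ioo h1 hF.continuousOn
  cases s with
  | start =>
    refine tendsto_nhds_unique (h3 : Tendsto F' (𝓝[>] 0) (𝓝 a)) ?_
    refine Tendsto.congr' ?_ (hF.continuousWithinAt (s := Ioi 0) (x := 0)).tendsto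
    filter_upwards [Ioo_mem_nhdsGT hl] with t ht
    exact (heq ht).symm
  | finish =>
    refine tendsto_nhds_unique (h3 : Tendsto F' (𝓝[<] l) (𝓝 a)) ?_
    refine Tendsto.congr' ?_ (hF.continuousWithinAt (s := Iio l) (x := l)).tendsto
    filter_upwards [Ioo_mem_nhdsLT hl] with t ht
    exact (heq ht).symm

lemma eqOn_Icc_of_ae_eq (hl : 0 < l) {F F' : ℝ → ℂ} (hF : Continuous F) (hF' : Continuous F')
    (h : F =ᵐ[edgeMeasure l] F') : EqOn F F' (Icc 0 l) := by
  have heq : EqOn F F' (Ioo 0 l) :=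
    Measure.eqOn_open_of_ae_eq (μ := volume) h isOpen_Ioo hF.continuousOn hF'.continuousOn
  rw [← closure_Ioo hl.ne]
  exact heq.closure hF hF'

end Representative

/-! ### The Wirtinger inequality -/

section Wirtinger

variable {F G : ℝ → ℂ}

/-- The Wirtinger inequality with a constant below the optimal one. -/
lemma wirtinger_of_lt {a b κ : ℝ} (hab : a ≤ b) (hκ : 0 < κ) (hlt : κ * (b - a) < Real.pi)
    (hF : ∀ t, HasDerivAt F (G t) t) (hG : Continuous G) (ha : F a = 0) (hb : F b = 0) :
    κ ^ 2 * ∫ t in a..b, ‖F t‖ ^ 2 ≤ ∫ t in a..b, ‖G t‖ ^ 2 := by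
  have hFc : Continuous F := continuous_iff_continuousAt.2 fun t => (hF t).continuousAt
  -- The room left by $\kappa(b-a)<\pi$ is divided equally between the two ends: the phase $A$ runs
  -- from $\varepsilon$ to $\pi-\varepsilon$, so its sine is positive on the closed interval.
  set ε : ℝ := (Real.pi - κ * (b - a)) / 2 with hε
  have hε0 : 0 < ε := by rw [hε]; linarith
  set A : ℝ → ℝ := fun t => κ * (t - a) + ε with hA
  have hsin : ∀ t ∈ Icc a b, 0 < Real.sin (A t) := by
    intro t ht
    have h1 : κ * (t - a) ≤ κ * (b - a) := by
      apply mul_le_mul_of_nonneg_left _ hκ.le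
      linarith [ht.2]
    have h2 : 0 ≤ κ * (t - a) := mul_nonneg hκ.le (by linarith [ht.1])
    apply Real.sin_pos_of_pos_of_lt_pi
    · simp only [hA]; linarith
    · simp only [hA]; linarith
  -- The logarithmic derivative of $\sin A$; it solves the Riccati equation
  -- $\theta'=-\kappa^2-\theta^2$.
  set θ : ℝ → ℝ := fun t => κ * (Real.cos (A t) / Real.sin (A t)) with hθ
  have hAd : ∀ t, HasDerivAt A κ t := by
    intro t
    have := (((hasDerivAt_id t).sub_const a).const_mul κ).add_const ε
    simpa [hA] using this
  have hθd : ∀ t ∈ Icc a b, HasDerivAt θ (-(κ ^ 2) - θ t ^ 2) t := by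
    intro t ht
    have hs := (hsin t ht).ne'
    have := (((hAd t).cos.div (hAd t).sin hs).const_mul κ)
    refine this.congr_deriv ?_
    simp only [hθ]
    field_simp
  have hθc : ContinuousOn θ (Icc a b) := fun t ht => (hθd t ht).continuousAt.continuousWithinAt
  set D : ℝ → ℝ := fun t => 2 * inner ℝ (F t) (G t) * θ t + ‖F t‖ ^ 2 * (-(κ ^ 2) - θ t ^ 2)
    with hD
  have hDd : ∀ t ∈ Icc a b, HasDerivAt (fun t => ‖F t‖ ^ 2 * θ t) (D t) t := fun t ht =>
    (hF t).norm_sq.mul (hθd t ht)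
  have hDc : ContinuousOn D (Icc a b) := by
    refine ContinuousOn.add ?_ ?_
    · exact (((hFc.inner hG).const_mul 2).continuousOn).mul hθc
    · exact (hFc.norm.pow 2).continuousOn.mul (continuousOn_const.sub (hθc.pow 2))
  have hDi : ∫ t in a..b, D t = 0 := by
    rw [intervalIntegral.integral_eq_sub_of_hasDerivAt (f := fun t => ‖F t‖ ^ 2 * θ t)]
    · simp [ha, hb]
    · rwa [uIcc_of_le hab]
    · exact hDc.intervalIntegrable_of_Icc hab
  have hFi : IntervalIntegrable (fun t => κ ^ 2 * ‖F t‖ ^ 2) volume a b :=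
    (continuous_const.mul (hFc.norm.pow 2)).intervalIntegrable _ _
  rw [← intervalIntegral.integral_const_mul, ← add_zero (∫ t in a..b, κ ^ 2 * ‖F t‖ ^ 2), ← hDi,
    ← intervalIntegral.integral_add hFi (hDc.intervalIntegrable_of_Icc hab)]
  refine intervalIntegral.integral_mono_on hab
    (hFi.add (hDc.intervalIntegrable_of_Icc hab)) ((hG.norm.pow 2).intervalIntegrable _ _) ?_
  intro t _
  -- Completing the square gives $|G|^2-\kappa^2|F|^2=|G-\theta F|^2+D$, where $D=(|F|^2\theta)'$
  -- has integral zero since $F$ vanishes at $a$ and $b$.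
  have h1 : ‖G t - θ t • F t‖ ^ 2 =
      ‖G t‖ ^ 2 - 2 * (θ t * inner ℝ (F t) (G t)) + θ t ^ 2 * ‖F t‖ ^ 2 := by
    rw [norm_sub_sq_real, inner_smul_right, real_inner_comm, norm_smul, mul_pow, Real.norm_eq_abs,
      sq_abs]
  have h2 := sq_nonneg ‖G t - θ t • F t‖
  rw [h1] at h2
  simp only [hD]
  linarith

/-- A function which vanishes at `m + 2` equidistant nodes and whose derivative is small in the
mean is zero. -/
lemma wirtinger_nodes {l κ : ℝ} (m : ℕ) (hl : 0 < l) (hκ : 0 < κ)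
    (hlt : κ * l < (m + 1) * Real.pi) (hF : ∀ t, HasDerivAt F (G t) t) (hG : Continuous G)
    (h0 : ∀ j : ℕ, j ≤ m + 1 → F (j * l / (m + 1)) = 0) :
    κ ^ 2 * ∫ t in (0 : ℝ)..l, ‖F t‖ ^ 2 ≤ ∫ t in (0 : ℝ)..l, ‖G t‖ ^ 2 := by
  have hFc : Continuous F := continuous_iff_continuousAt.2 fun t => (hF t).continuousAt
  have hm : (0 : ℝ) < m + 1 := by positivity
  set x : ℕ → ℝ := fun j => j * l / (m + 1) with hx
  have hx0 : x 0 = 0 := by simp [hx]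
  have hxl : x (m + 1) = l := by
    simp only [hx]
    push_cast
    field_simp
  have hstep : ∀ j, x (j + 1) - x j = l / (m + 1) := by
    intro j
    simp only [hx]
    push_cast
    field_simp
    ring
  have e1 := intervalIntegral.sum_integral_adjacent_intervals (μ := volume)
    (f := fun t => ‖F t‖ ^ 2) (a := x) (n := m + 1)
    fun j _ => (hFc.norm.pow 2).intervalIntegrable _ _
  have e2 := intervalIntegral.sum_integral_adjacent_intervals (μ := volume)
    (f := fun t => ‖G t‖ ^ 2) (a := x) (n := m + 1)
    fun j _ => (hG.norm.pow 2).intervalIntegrable _ _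
  rw [hx0, hxl] at e1 e2
  rw [← e1, ← e2, Finset.mul_sum]
  refine Finset.sum_le_sum fun j hj => ?_
  have hj' := Finset.mem_range.1 hj
  refine wirtinger_of_lt ?_ hκ ?_ hF hG (h0 j (by omega)) (h0 (j + 1) (by omega))
  · have := hstep j
    have : 0 < l / (m + 1) := by positivity
    linarith
  · rw [hstep, ← mul_div_assoc, div_lt_iff₀ hm]
    linarith

end Wirtinger


/-! ### Counting functions of symmetric operators -/

section Abstract

variable {H : Type*} [NormedAddCommGroup H] [InnerProductSpace ℂ H]

/-- The eigenspace of a partially defined operator. -/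
def pEigenspace (T : H →ₗ.[ℂ] H) (μ : ℝ) : Submodule ℂ H where
  carrier := {x | ∃ hx : x ∈ T.domain, T ⟨x, hx⟩ = (μ : ℂ) • x}
  zero_mem' := ⟨T.domain.zero_mem, by
    rw [smul_zero]
    exact T.map_zero⟩
  add_mem' := by
    rintro x y ⟨hx, hx'⟩ ⟨hy, hy'⟩
    refine ⟨T.domain.add_mem hx hy, ?_⟩
    rw [smul_add, ← hx', ← hy', ← T.map_add]
    rfl
  smul_mem' := by
    rintro c x ⟨hx, hx'⟩
    refine ⟨T.domain.smul_mem c hx, ?_⟩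
    rw [smul_comm, ← hx', ← T.map_smul]
    rfl

variable {T : H →ₗ.[ℂ] H} {lam : ℝ}

/-- A finite-dimensional spectrally bounded subspace is spanned by eigenvectors. -/
lemma IsSpectrallyBelow.le_iSup_pEigenspace (hT : T.IsFormalAdjoint T) {M : Submodule ℂ H}
    (hM : IsSpectrallyBelow T lam M) [FiniteDimensional ℂ M] :
    M ≤ ⨆ μ : Iic lam, pEigenspace T μ := by
  let S : M →ₗ[ℂ] M :=
    { toFun := fun x => ⟨T ⟨x, hM.le_domain x.2⟩, hM.invariant ⟨x, hM.le_domain x.2⟩ x.2⟩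
      map_add' := fun x y => by
        ext
        exact T.map_add ⟨x, hM.le_domain x.2⟩ ⟨y, hM.le_domain y.2⟩
      map_smul' := fun c x => by
        ext
        exact T.map_smul c ⟨x, hM.le_domain x.2⟩ }
  have hS : S.IsSymmetric := fun x y =>
    hT ⟨x, hM.le_domain x.2⟩ ⟨y, hM.le_domain y.2⟩
  -- The finite-dimensional spectral theorem, applied to the restriction of `T` to the invariant
  -- subspace `M`.
  have htop : ⨆ μ, Module.End.eigenspace S μ = ⊤ :=
    Submodule.orthogonal_eq_bot_iff.1 hS.orthogonalComplement_iSup_eigenspaces_eq_bot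
  have hmap : M = Submodule.map M.subtype (⨆ μ, Module.End.eigenspace S μ) := by
    rw [htop, Submodule.map_top, Submodule.range_subtype]
  rw [hmap, Submodule.map_iSup]
  refine iSup_le fun μ => ?_
  rintro _ ⟨x, hx, rfl⟩
  by_cases hx0 : x = 0
  · simp [hx0]
  have hx1 : S x = μ • x := Module.End.mem_eigenspace_iff.1 hx
  have hev : Module.End.HasEigenvalue S μ := Module.End.hasEigenvalue_of_hasEigenvector ⟨hx, hx0⟩
  have hμ : ((μ.re : ℝ) : ℂ) = μ := Complex.conj_eq_iff_re.1 (hS.conj_eigenvalue_eq_self hev)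
  have hTx : T ⟨x, hM.le_domain x.2⟩ = ((μ.re : ℝ) : ℂ) • (x : H) := by
    rw [hμ]
    exact congrArg Subtype.val hx1
  have hle : μ.re ≤ lam := by
    have h1 := hM.le ⟨x, hM.le_domain x.2⟩ x.2
    rw [hTx, inner_smul_left, inner_self_eq_norm_sq_to_K, Complex.conj_ofReal] at h1
    have h2 : 0 < ‖(x : H)‖ ^ 2 := by
      have : (x : H) ≠ 0 := fun h => hx0 (Subtype.ext h)
      positivity
    refine le_of_mul_le_mul_right (le_trans (le_of_eq ?_) h1) h2
    change _ = Complex.re (_ * ((‖(x : H)‖ : ℂ)) ^ 2)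
    rw [← Complex.ofReal_pow, ← Complex.ofReal_mul, Complex.ofReal_re]
  exact Submodule.mem_iSup_of_mem (⟨μ.re, hle⟩ : Iic lam) ⟨hM.le_domain x.2, hTx⟩

lemma pEigenspace_orthogonal (hT : T.IsFormalAdjoint T) {μ ν : ℝ} (hne : μ ≠ ν) {x y : H}
    (hx : x ∈ pEigenspace T μ) (hy : y ∈ pEigenspace T ν) : inner ℂ x y = 0 := by
  obtain ⟨hx1, hx2⟩ := hx
  obtain ⟨hy1, hy2⟩ := hy
  have h := hT ⟨x, hx1⟩ ⟨y, hy1⟩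
  simp only at h
  rw [hx2, hy2, inner_smul_left, inner_smul_right, Complex.conj_ofReal] at h
  have h1 : ((μ - ν : ℝ) : ℂ) * inner ℂ x y = 0 := by
    push_cast
    rw [sub_mul, h, sub_self]
  rcases mul_eq_zero.1 h1 with h2 | h2
  · exact absurd (sub_eq_zero.1 (Complex.ofReal_eq_zero.1 h2)) hne
  · exact h2

lemma iSup_pEigenspace_le_domain : ⨆ μ : Iic lam, pEigenspace T μ ≤ T.domain :=
  iSup_le fun _ _ hx => hx.1

/-- Orthogonality of the eigenspaces diagonalises both the form and the norm, so the bound reduces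
to $\mu\le\lambda$ for each component. -/
lemma inner_le_of_mem_iSup_pEigenspace (hT : T.IsFormalAdjoint T) (x : T.domain)
    (hx : (x : H) ∈ ⨆ μ : Iic lam, pEigenspace T μ) :
    RCLike.re (inner ℂ (T x) (x : H)) ≤ lam * ‖(x : H)‖ ^ 2 := by
  classical
  obtain ⟨f, hf, hsum⟩ := (Submodule.mem_iSup_iff_exists_finsupp _ _).1 hx
  have hf1 : ∀ μ, ∃ h : f μ ∈ T.domain, T ⟨f μ, h⟩ = ((μ : ℝ) : ℂ) • f μ := hf
  choose hd hT' using hf1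
  rw [Finsupp.sum] at hsum
  have hxs : x = ∑ μ ∈ f.support, (⟨f μ, hd μ⟩ : T.domain) := by
    ext
    rw [← hsum]
    simp
  have hTx : T x = ∑ μ ∈ f.support, ((μ : ℝ) : ℂ) • f μ := by
    rw [hxs]
    change T.toFun _ = _
    rw [map_sum]
    exact Finset.sum_congr rfl fun μ _ => hT' μ
  have horth : ∀ μ ν : Iic lam, μ ≠ ν → inner ℂ (f μ) (f ν) = 0 := fun μ ν hne =>
    pEigenspace_orthogonal hT (fun h => hne (Subtype.ext h)) (hf μ) (hf ν)
  have h1 : ∀ c : Iic lam → ℂ, inner ℂ (∑ μ ∈ f.support, c μ • f μ) (∑ μ ∈ f.support, f μ) =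
      ∑ μ ∈ f.support, (starRingEnd ℂ) (c μ) * (‖f μ‖ : ℂ) ^ 2 := by
    intro c
    rw [sum_inner]
    refine Finset.sum_congr rfl fun μ hμ => ?_
    rw [inner_sum, Finset.sum_eq_single μ]
    · rw [inner_smul_left, inner_self_eq_norm_sq_to_K]
      rfl
    · intro ν _ hne
      rw [inner_smul_left, horth μ ν hne.symm, mul_zero]
    · exact fun h => absurd hμ h
  have h2 : inner ℂ (T x) (x : H) = ((∑ μ ∈ f.support, (μ : ℝ) * ‖f μ‖ ^ 2 : ℝ) : ℂ) := by
    rw [hTx, ← hsum, h1]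
    push_cast
    simp only [Complex.conj_ofReal]
  have h3 : ‖(x : H)‖ ^ 2 = ∑ μ ∈ f.support, ‖f μ‖ ^ 2 := by
    have h4 := h1 fun _ => 1
    simp only [one_smul, map_one, one_mul] at h4
    rw [hsum, inner_self_eq_norm_sq_to_K] at h4
    have h5 : ((‖(x : H)‖ ^ 2 : ℝ) : ℂ) = ((∑ μ ∈ f.support, ‖f μ‖ ^ 2 : ℝ) : ℂ) := by
      push_cast
      exact h4
    exact Complex.ofReal_injective h5
  have h6 : RCLike.re (inner ℂ (T x) (x : H)) = ∑ μ ∈ f.support, (μ : ℝ) * ‖f μ‖ ^ 2 := by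
    rw [h2]
    exact Complex.ofReal_re _
  rw [h6, h3, Finset.mul_sum]
  exact Finset.sum_le_sum fun μ _ => mul_le_mul_of_nonneg_right μ.2 (sq_nonneg _)

/-- If the dimension of the subspaces on which a symmetric operator is bounded by `lam` in the
sense of forms is at most `n`, then so is its counting function at `lam`. -/
lemma countingFunction_le (hT : T.IsFormalAdjoint T) {n : ℕ}
    (h : ∀ M : Submodule ℂ H, M ≤ T.domain →
      (∀ x : T.domain, (x : H) ∈ M → RCLike.re (inner ℂ (T x) (x : H)) ≤ lam * ‖(x : H)‖ ^ 2) →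
      Module.rank ℂ M ≤ n) :
    countingFunction T lam ≤ n := by
  have h1 : spectralSubspace T lam ≤ ⨆ μ : Iic lam, pEigenspace T μ := by
    refine sSup_le fun M hM => ?_
    have hM' : Module.rank ℂ M ≤ n := h M hM.le_domain hM.le
    have : FiniteDimensional ℂ M :=
      Module.rank_lt_aleph0_iff.1 (hM'.trans_lt Cardinal.natCast_lt_aleph0)
    exact hM.le_iSup_pEigenspace hT
  -- The hypothesis is used a second time, now for the sum of the eigenspaces, which satisfies the
  -- form bound although it is not known to be closed.
  have h2 : Module.rank ℂ (spectralSubspace T lam) ≤ n :=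
    (Submodule.rank_mono h1).trans
      (h _ iSup_pEigenspace_le_domain (inner_le_of_mem_iSup_pEigenspace hT))
  have h3 := OrderHomClass.mono Cardinal.toENat h2
  simpa [countingFunction] using h3

/-- The dimension of a space is bounded by the number of a family of values assigned linearly to
its elements, if only `0` can be assigned the values `0`. -/
lemma rank_le_card_of_relation {ι : Type*} [Fintype ι] (M : Submodule ℂ H)
    (R : Submodule ℂ (H × (ι → ℂ))) (hR : ∀ x ∈ M, ∃ y, (x, y) ∈ R)
    (h0 : ∀ x ∈ M, (x, 0) ∈ R → x = 0) : Module.rank ℂ M ≤ Fintype.card ι := by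
  -- The part of the relation over `M` projects onto `M`, and embeds into `ι → ℂ` by the second
  -- coordinate. A relation avoids a linear choice of values.
  let R' : Submodule ℂ (H × (ι → ℂ)) := R ⊓ M.comap (LinearMap.fst ℂ H (ι → ℂ))
  have h1 : M ≤ R'.map (LinearMap.fst ℂ H (ι → ℂ)) := fun x hx => by
    obtain ⟨y, hy⟩ := hR x hx
    exact ⟨(x, y), ⟨hy, hx⟩, rfl⟩
  let Φ : R' →ₗ[ℂ] (ι → ℂ) := (LinearMap.snd ℂ H (ι → ℂ)).comp R'.subtype
  have h2 : Function.Injective Φ := by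
    refine (injective_iff_map_eq_zero Φ).2 ?_
    rintro ⟨⟨x, y⟩, hxy, hx⟩ hΦ
    have hy : y = 0 := hΦ
    subst hy
    have : x = 0 := h0 x hx hxy
    subst this
    rfl
  have h3 : FiniteDimensional ℂ R' := Module.Finite.of_injective Φ h2
  have h4 := LinearMap.finrank_le_finrank_of_injective h2
  rw [Module.finrank_pi] at h4
  have h5 : FiniteDimensional ℂ M := Submodule.finiteDimensional_of_le h1
  rw [← Module.finrank_eq_rank, Nat.cast_le]
  exact (Submodule.finrank_mono h1).trans ((Submodule.finrank_map_le _ _).trans h4)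

end Abstract


/-! ### Green's formula -/

instance : Fintype Side where
  elems := ⟨{Side.start, Side.finish}, by simp⟩
  complete s := by cases s <;> simp

lemma Side.sum_eq {M : Type*} [AddCommMonoid M] (a : Side → M) :
    ∑ s, a s = a Side.start + a Side.finish := by
  change (Multiset.map a {Side.start, Side.finish}).sum = _
  simp

section Green

/-- The sesquilinear form of `-f'' + W f` on the interval `(0, l)`. -/
noncomputable def edgeForm (l : ℝ) (W : ℝ → ℝ) (F₁ G₁ F₂ G₂ : ℝ → ℂ) : ℂ :=
  ∫ t, conj (G₁ t) * G₂ t ∂(edgeMeasure l) + ∫ t, conj (F₁ t) * ((W t : ℂ) * F₂ t) ∂(edgeMeasure l)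

lemma conj_edgeForm (l : ℝ) (W : ℝ → ℝ) (F₁ G₁ F₂ G₂ : ℝ → ℂ) :
    conj (edgeForm l W F₁ G₁ F₂ G₂) = edgeForm l W F₂ G₂ F₁ G₁ := by
  unfold edgeForm
  rw [map_add, ← integral_conj, ← integral_conj]
  congr 2 <;>
  · ext t
    simp only [map_mul, Complex.conj_conj, Complex.conj_ofReal]
    ring

lemma inner_edge_eq {l : ℝ} {W : ℝ → ℝ} {f f' f'' h g g' g'' : Lp ℂ 2 (edgeMeasure l)}
    {F G F₂ G₂ : ℝ → ℂ} (hf : IsC1Rep l f f' f'' F G) (hg : IsC1Rep l g g' g'' F₂ G₂)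
    (hh : h =ᵐ[edgeMeasure l] fun t => -(f'' t) + (W t : ℂ) * f t) :
    Integrable (fun t => conj (F₂ t) * ((W t : ℂ) * F t)) (edgeMeasure l) ∧
    inner ℂ g h = edgeForm l W F₂ G₂ F G +
      ∑ s : Side, conj (F₂ (s.pos l)) * (s.sgn * G (s.pos l)) := by
  have hc : Continuous fun t => conj (F₂ t) := Complex.continuous_conj.comp hg.continuous_self
  -- Neither measurability nor boundedness of $W$ is needed: $Wf=h+f''$ almost everywhere, and the
  -- right side is integrable.
  have hi : Integrable (fun t => conj (F₂ t) * ((W t : ℂ) * F t)) (edgeMeasure l) := by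
    refine (integrable_mul_edge ((integrable_edge h).add (integrable_edge f'')) hc).congr ?_
    filter_upwards [hh, hf.ae_eq] with t h1 h2
    rw [Pi.add_apply, h1, h2]
    ring
  refine ⟨hi, ?_⟩
  have h1 : inner ℂ g h = ∫ t, (conj (F₂ t) * ((W t : ℂ) * F t) - conj (F₂ t) * f'' t)
      ∂(edgeMeasure l) := by
    rw [L2.inner_def]
    apply integral_congr_ae
    filter_upwards [hh, hf.ae_eq, hg.ae_eq] with t h1 h2 h3
    rw [RCLike.inner_apply, h1, h2, h3]
    ring
  have h2 := hf.parts (fun t => conj (F₂ t)) (fun t => conj (G₂ t))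
    (fun t => (hg.hasDerivAt t).star) (Complex.continuous_conj.comp hg.continuous)
  rw [h1, integral_sub hi (integrable_mul_edge (integrable_edge f'') hc), h2, Side.sum_eq, edgeForm]
  simp only [Side.pos, Side.sgn]
  ring

variable {E V : Type*} {Γ : MetricGraph E V} {B : VertexCondition Γ} {W : E → ℝ → ℝ} {E₁ : Set E}

/-- The family of the representatives on the edges. -/
def IsRep (f f' f'' : L2Space Γ E₁) (F G : E₁ → ℝ → ℂ) : Prop :=
  ∀ e : E₁, IsC1Rep (Γ.len e) (f e) (f' e) (f'' e) (F e) (G e)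

lemma IsInGraph.exists_isRep {f f' f'' h : L2Space Γ E₁} (H : IsInGraph B W E₁ f f' f'' h) :
    ∃ F G, IsRep f f' f'' F G := by
  choose F G hFG using fun e : E₁ => exists_isC1Rep (Γ.len_pos e) (H.deriv₁ e) (H.deriv₂ e)
  exact ⟨F, G, hFG⟩

lemma exists_isInGraph (x : (schroedinger B W E₁).domain) :
    ∃ f' f'', IsInGraph B W E₁ x f' f'' (schroedinger B W E₁ x) := by
  have h := (schroedinger B W E₁).mem_graph x
  rw [schroedinger_graph] at h
  exact h

/-- The values at the end `p` of a family of functions on the edges. -/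
def endValue (F : E₁ → ℝ → ℂ) (p : E₁ × Side) : ℂ := F p.1 (p.2.pos (Γ.len p.1))

lemma IsRep.trace_eq {f f' f'' : L2Space Γ E₁} {F G : E₁ → ℝ → ℂ}
    (hF : IsRep f f' f'' F G) {p : E × Side} (hp : p.1 ∈ E₁) {a b : ℂ}
    (h₁ : HasBoundaryValue (Γ.len p.1) (f ⟨p.1, hp⟩) p.2 a)
    (h₂ : HasBoundaryValue (Γ.len p.1) (p.2.sgn • f' ⟨p.1, hp⟩) p.2 b) :
    a = endValue (Γ := Γ) F (⟨p.1, hp⟩, p.2) ∧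
      b = p.2.sgn * endValue (Γ := Γ) G (⟨p.1, hp⟩, p.2) := by
  have hr := hF ⟨p.1, hp⟩
  refine ⟨h₁.eq_of_continuous (Γ.len_pos _) hr.continuous_self hr.ae_eq,
    h₂.eq_of_continuous (F := fun t => p.2.sgn * G ⟨p.1, hp⟩ t) (Γ.len_pos _)
      (continuous_const.mul hr.continuous) ?_⟩
  filter_upwards [Lp.coeFn_smul p.2.sgn (f' ⟨p.1, hp⟩), hr.ae_eq'] with t h1 h2
  rw [h1, Pi.smul_apply, h2, smul_eq_mul]

/-- The traces lie in the kernel of the self-adjoint $P_v$, so $\eta$ may be replaced by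
$(1-P_v)\eta=L_v\xi$ in the inner products; what remains is the symmetry of $L_v$. -/
lemma VertexCondition.Holds.inner_comm {v : V} {ξ η ξ' η' : Γ.EndSpace v} (h : B.Holds v ξ η)
    (h' : B.Holds v ξ' η') : conj (inner ℂ ξ' η) = inner ℂ ξ η' := by
  obtain ⟨z, rfl, h2⟩ := h
  obtain ⟨z', rfl, h2'⟩ := h'
  have hP : ∀ (w : (B.P v).ker) (y : Γ.EndSpace v),
      inner ℂ (w : Γ.EndSpace v) (y - B.P v y) = inner ℂ (w : Γ.EndSpace v) y := by
    intro w y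
    have h1 : inner ℂ (B.P v (w : Γ.EndSpace v)) y = inner ℂ (w : Γ.EndSpace v) (B.P v y) :=
      (B.isStarProjection v).isSelfAdjoint.isSymmetric _ _
    rw [inner_sub_right, ← h1, show B.P v (w : Γ.EndSpace v) = 0 from w.2, inner_zero_left, sub_zero]
  rw [← hP _ η, ← hP _ η', ← h2, ← h2', inner_conj_symm]
  have hL : (B.L v).IsFormalAdjoint (B.L v) := by
    have h3 := LinearPMap.adjoint_isFormalAdjoint (B.isSelfAdjoint v).dense_domain
    rwa [show (B.L v).adjoint = B.L v from B.isSelfAdjoint v] at h3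
  exact hL z z'

variable [Fintype E₁]

/-- The sum over edge ends is regrouped by vertices. An inner vertex contributes a Hermitian term by
its vertex condition, and a boundary vertex contributes nothing by the Dirichlet condition. -/
lemma conj_sum_ends {f f' f'' h g g' g'' k : L2Space Γ E₁} {F G F₂ G₂ : E₁ → ℝ → ℂ}
    (Hf : IsInGraph B W E₁ f f' f'' h) (Hg : IsInGraph B W E₁ g g' g'' k)
    (hF : IsRep f f' f'' F G) (hF₂ : IsRep g g' g'' F₂ G₂) :
    conj (∑ p : E₁ × Side, conj (endValue (Γ := Γ) F₂ p) * (p.2.sgn * endValue (Γ := Γ) G p)) =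
      ∑ p : E₁ × Side, conj (endValue (Γ := Γ) F p) * (p.2.sgn * endValue (Γ := Γ) G₂ p) := by
  classical
  let ve : E₁ × Side → V := fun p => Γ.endVertex (p.1.1, p.2)
  rw [← Finset.sum_fiberwise_of_maps_to (s := Finset.univ) (t := Finset.univ.image ve) (g := ve)
      (fun p hp => Finset.mem_image_of_mem _ hp), map_sum,
    ← Finset.sum_fiberwise_of_maps_to (s := Finset.univ) (t := Finset.univ.image ve) (g := ve)
      (fun p hp => Finset.mem_image_of_mem _ hp)]
  refine Finset.sum_congr rfl fun v hv => ?_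
  obtain ⟨p₀, -, hp₀⟩ := Finset.mem_image.1 hv
  by_cases hin : Γ.IsInner E₁ v
  · obtain ⟨ξ, η, h1, h2⟩ := Hf.inner_cond v hin
    obtain ⟨ξ', η', h1', h2'⟩ := Hg.inner_cond v hin
    -- At an inner vertex every incident edge belongs to `E₁`, so the group of ends at `v` is all of
    -- $E_v$, with loops counted twice. This turns the partial sum into the inner product of
    -- $\ell^2(E_v)$.
    let eqv : {p : E₁ × Side // ve p = v} ≃ Γ.Ends v :=
      { toFun := fun p => ⟨(p.1.1.1, p.1.2), p.2⟩
        invFun := fun p => ⟨(⟨p.1.1, hin p⟩, p.1.2), p.2⟩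
        left_inv := fun p => rfl
        right_inv := fun p => rfl }
    have hsum : ∀ x y : Γ.EndSpace v, inner ℂ x y =
        ∑ p : {p : E₁ × Side // ve p = v}, inner ℂ (x (eqv p)) (y (eqv p)) := by
      intro x y
      rw [lp.inner_eq_tsum, ← eqv.tsum_eq, tsum_fintype]
    have key : ∀ {x y : Γ.EndSpace v} {a b : E₁ × Side → ℂ}, (∀ p, x (eqv p) = a p) →
        (∀ p, y (eqv p) = b p) →
        ∑ p ∈ Finset.univ.filter (fun p => ve p = v), conj (a p) * b p = inner ℂ x y := by
      intro x y a b hx hy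
      rw [hsum, Finset.sum_subtype (p := fun p => ve p = v) _ (by simp)]
      refine Finset.sum_congr rfl fun p _ => ?_
      rw [hx, hy, RCLike.inner_apply, mul_comm]
    have t1 := fun p => IsRep.trace_eq hF (hin (eqv p)) (h1 (eqv p) (hin _)).1
      (h1 (eqv p) (hin _)).2
    have t2 := fun p => IsRep.trace_eq hF₂ (hin (eqv p)) (h1' (eqv p) (hin _)).1
      (h1' (eqv p) (hin _)).2
    rw [key (fun p => (t2 p).1) (fun p => (t1 p).2), key (fun p => (t1 p).1) (fun p => (t2 p).2)]
    exact h2.inner_comm h2'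
  · have hbd : Γ.IsBoundary E₁ v := by
      refine ⟨⟨⟨(p₀.1.1, p₀.2), hp₀⟩, p₀.1.2⟩, ?_⟩
      simpa [MetricGraph.IsInner] using hin
    have hz : ∀ {f f' f'' h : L2Space Γ E₁} {F G : E₁ → ℝ → ℂ}, IsInGraph B W E₁ f f' f'' h →
        IsRep f f' f'' F G → ∀ p, ve p = v → endValue (Γ := Γ) F p = 0 := by
      intro f f' f'' h F G H hF p hp
      exact ((H.boundary_cond v hbd ⟨(p.1.1, p.2), hp⟩ p.1.2).eq_of_continuous (Γ.len_pos _)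
        (hF p.1).continuous_self (hF p.1).ae_eq).symm
    rw [Finset.sum_eq_zero, Finset.sum_eq_zero, map_zero]
    · intro p hp
      rw [hz Hf hF p (Finset.mem_filter.1 hp).2, map_zero, zero_mul]
    · intro p hp
      rw [hz Hg hF₂ p (Finset.mem_filter.1 hp).2, map_zero, zero_mul]

lemma green {f f' f'' h g g' g'' : L2Space Γ E₁} {F G F₂ G₂ : E₁ → ℝ → ℂ}
    (Hf : IsInGraph B W E₁ f f' f'' h)
    (hF : IsRep f f' f'' F G) (hF₂ : IsRep g g' g'' F₂ G₂) :
    inner ℂ g h = ∑ e : E₁, edgeForm (Γ.len e) (W e) (F₂ e) (G₂ e) (F e) (G e) +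
      ∑ p : E₁ × Side, conj (endValue (Γ := Γ) F₂ p) * (p.2.sgn * endValue (Γ := Γ) G p) := by
  rw [lp.inner_eq_tsum, tsum_fintype, Fintype.sum_prod_type, ← Finset.sum_add_distrib]
  exact Finset.sum_congr rfl fun e _ =>
    (inner_edge_eq (hF e) (hF₂ e) (Hf.eq e)).2

lemma schroedinger_isFormalAdjoint :
    (schroedinger B W E₁).IsFormalAdjoint (schroedinger B W E₁) := by
  intro x y
  obtain ⟨f', f'', Hf⟩ := exists_isInGraph x
  obtain ⟨g', g'', Hg⟩ := exists_isInGraph y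
  obtain ⟨F, G, hF⟩ := Hf.exists_isRep
  obtain ⟨F₂, G₂, hF₂⟩ := Hg.exists_isRep
  rw [← inner_conj_symm, green Hf hF hF₂,
    green Hg hF₂ hF, map_add, map_sum, conj_sum_ends Hf Hg hF hF₂]
  simp only [conj_edgeForm]

end Green


/-! ### The Weyl bound -/

section Weyl

variable {E V : Type*} {Γ : MetricGraph E V} {B : VertexCondition Γ} {W : E → ℝ → ℝ} {E₁ : Set E}

lemma edgeForm_re_ge {l C : ℝ} {W : ℝ → ℝ} {F G : ℝ → ℂ} (hF : Continuous F)
    (hi : Integrable (fun t => conj (F t) * ((W t : ℂ) * F t)) (edgeMeasure l))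
    (hW : ∀ᵐ t ∂(edgeMeasure l), -C ≤ W t) :
    ∫ t, ‖G t‖ ^ 2 ∂(edgeMeasure l) - C * ∫ t, ‖F t‖ ^ 2 ∂(edgeMeasure l) ≤
      (edgeForm l W F G F G).re := by
  have h1 : ∫ t, conj (G t) * G t ∂(edgeMeasure l) =
      ((∫ t, ‖G t‖ ^ 2 ∂(edgeMeasure l) : ℝ) : ℂ) := by
    rw [← integral_complex_ofReal]
    congr 1
    ext t
    rw [Complex.conj_mul']
    push_cast
    rfl
  have h2 : ∀ t, conj (F t) * ((W t : ℂ) * F t) = ((W t * ‖F t‖ ^ 2 : ℝ) : ℂ) := by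
    intro t
    push_cast
    rw [← Complex.conj_mul']
    ring
  simp only [h2] at hi
  have hi' : Integrable (fun t => W t * ‖F t‖ ^ 2) (edgeMeasure l) := by
    simpa only [RCLike.re_eq_complex_re, Complex.ofReal_re] using hi.re
  rw [edgeForm, h1]
  simp only [h2]
  rw [integral_complex_ofReal, Complex.add_re, Complex.ofReal_re, Complex.ofReal_re, sub_eq_add_neg,
    ← neg_mul, ← integral_const_mul]
  refine add_le_add le_rfl ?_
  refine integral_mono_ae (f := fun t => -C * ‖F t‖ ^ 2)
    (integrable_edge_of_continuous (continuous_const.mul (hF.norm.pow 2))) hi' ?_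
  filter_upwards [hW] with t ht
  exact mul_le_mul_of_nonneg_right ht (sq_nonneg _)

lemma norm_sq_eq_of_ae_eq {l : ℝ} {f : Lp ℂ 2 (edgeMeasure l)} {F : ℝ → ℂ}
    (h : f =ᵐ[edgeMeasure l] F) : ‖f‖ ^ 2 = ∫ t, ‖F t‖ ^ 2 ∂(edgeMeasure l) := by
  rw [← RCLike.ofReal_inj (K := ℂ), RCLike.ofReal_pow, ← inner_self_eq_norm_sq_to_K (𝕜 := ℂ),
    L2.inner_def]
  change _ = ((∫ t, ‖F t‖ ^ 2 ∂(edgeMeasure l) : ℝ) : ℂ)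
  rw [← integral_complex_ofReal]
  apply integral_congr_ae
  filter_upwards [h] with t ht
  rw [ht, inner_self_eq_norm_sq_to_K]
  push_cast
  rfl

/-- The relation between a function on the graph and the values of its continuous
representatives at the `m + 2` equidistant nodes of each edge. -/
def nodalRelation (Γ : MetricGraph E V) (E₁ : Set E) (m : ℕ) :
    Submodule ℂ (L2Space Γ E₁ × (E₁ × Fin (m + 2) → ℂ)) where
  carrier := {x | ∃ F : E₁ → ℝ → ℂ, ∀ e : E₁, Continuous (F e) ∧
    x.1 e =ᵐ[edgeMeasure (Γ.len e)] F e ∧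
    ∀ j : Fin (m + 2), x.2 (e, j) = F e ((j : ℕ) * Γ.len e / (m + 1))}
  zero_mem' := ⟨0, fun _ => ⟨continuous_const, Lp.coeFn_zero _ _ _, fun _ => rfl⟩⟩
  add_mem' := by
    rintro x y ⟨F, hF⟩ ⟨F', hF'⟩
    refine ⟨F + F', fun e => ⟨(hF e).1.add (hF' e).1,
      (Lp.coeFn_add (x.1 e) (y.1 e)).trans ((hF e).2.1.add (hF' e).2.1), fun j => ?_⟩⟩
    simp [(hF e).2.2 j, (hF' e).2.2 j]
  smul_mem' := by
    rintro c x ⟨F, hF⟩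
    refine ⟨c • F, fun e => ⟨(hF e).1.const_smul c,
      (Lp.coeFn_smul c (x.1 e)).trans ((hF e).2.1.const_smul c), fun j => ?_⟩⟩
    simp [(hF e).2.2 j]

variable [Fintype E₁]

/-- A function with vanishing nodal values on which the operator is small is zero. -/
lemma eq_zero_of_nodal {C lam κ : ℝ} {m : ℕ} (hκ : 0 < κ) (hκ' : lam + C < κ ^ 2)
    (hlen : ∀ e : E₁, κ * Γ.len e < (m + 1) * Real.pi)
    (hW : ∀ e : E₁, ∀ᵐ t ∂(edgeMeasure (Γ.len e)), -C ≤ W e t)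
    (x : (schroedinger B W E₁).domain)
    (hx : RCLike.re (inner ℂ (schroedinger B W E₁ x) (x : L2Space Γ E₁)) ≤
      lam * ‖(x : L2Space Γ E₁)‖ ^ 2)
    (h0 : ((x : L2Space Γ E₁), 0) ∈ nodalRelation Γ E₁ m) : (x : L2Space Γ E₁) = 0 := by
  obtain ⟨f', f'', Hf⟩ := exists_isInGraph x
  obtain ⟨F, G, hF⟩ := Hf.exists_isRep
  obtain ⟨F', hF'⟩ := h0
  have hm : (0 : ℝ) < m + 1 := by positivity
  have hnode : ∀ (e : E₁) (j : ℕ), j ≤ m + 1 → F e (j * Γ.len e / (m + 1)) = 0 := by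
    intro e j hj
    obtain ⟨h1, h2, h3⟩ := hF' e
    have hl := Γ.len_pos e
    rw [eqOn_Icc_of_ae_eq hl (hF e).continuous_self h1 ((hF e).ae_eq.symm.trans h2)]
    · exact (h3 ⟨j, by omega⟩).symm
    · refine ⟨by positivity, ?_⟩
      rw [div_le_iff₀ hm, mul_comm]
      exact mul_le_mul_of_nonneg_left (by exact_mod_cast hj) hl.le
  -- The first and the last node are the ends of the edge; this removes the vertex terms from
  -- Green's formula.
  have hend : ∀ p : E₁ × Side, endValue (Γ := Γ) F p = 0 := by
    rintro ⟨e, s⟩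
    cases s with
    | start => simpa [endValue, Side.pos] using hnode e 0 (by omega)
    | finish =>
      have := hnode e (m + 1) le_rfl
      push_cast at this
      rw [mul_div_cancel_left₀ _ hm.ne'] at this
      exact this
  have hgreen := green Hf hF hF
  simp only [hend, map_zero, zero_mul, Finset.sum_const_zero, add_zero] at hgreen
  have hnorm : ‖(x : L2Space Γ E₁)‖ ^ 2 =
      ∑ e : E₁, ∫ t, ‖F e t‖ ^ 2 ∂(edgeMeasure (Γ.len e)) := by
    have h1 := lp.norm_rpow_eq_tsum (p := 2) (by norm_num) (x : L2Space Γ E₁)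
    norm_num at h1
    rw [h1]
    exact Finset.sum_congr rfl fun e _ => norm_sq_eq_of_ae_eq (hF e).ae_eq
  have hge : ∑ e : E₁, (κ ^ 2 - C) * ∫ t, ‖F e t‖ ^ 2 ∂(edgeMeasure (Γ.len e)) ≤
      RCLike.re (inner ℂ (schroedinger B W E₁ x) (x : L2Space Γ E₁)) := by
    rw [inner_re_symm, hgreen, map_sum]
    refine Finset.sum_le_sum fun e _ => ?_
    refine le_trans ?_ (edgeForm_re_ge (hF e).continuous_self
      (inner_edge_eq (hF e) (hF e) (Hf.eq e)).1 (hW e))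
    rw [sub_mul]
    gcongr
    rw [edge_integral_eq (Γ.len_pos e).le, edge_integral_eq (Γ.len_pos e).le]
    exact wirtinger_nodes m (Γ.len_pos e) hκ (hlen e) (hF e).hasDerivAt (hF e).continuous (hnode e)
  rw [← Finset.mul_sum, ← hnorm] at hge
  have h2 : (κ ^ 2 - C - lam) * ‖(x : L2Space Γ E₁)‖ ^ 2 ≤ 0 := by linarith
  have h3 : ‖(x : L2Space Γ E₁)‖ ^ 2 ≤ 0 := by
    by_contra h4
    have : 0 < (κ ^ 2 - C - lam) * ‖(x : L2Space Γ E₁)‖ ^ 2 :=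
      mul_pos (by linarith) (not_le.1 h4)
    linarith
  have h5 : ‖(x : L2Space Γ E₁)‖ = 0 := by
    have := le_antisymm h3 (sq_nonneg _)
    exact pow_eq_zero_iff (two_ne_zero) |>.1 this
  exact norm_eq_zero.1 h5

/-- With this floor as $m$, there is room for $\kappa$ strictly between $\sqrt{\lambda+C}$ and
$(m+1)\pi/l_+$, which is what the nodal argument requires. For $\lambda+C<0$ the real square root is
0, so $m=0$ and only the two ends of each edge serve as nodes. -/
lemma countingFunction_schroedinger_le {C lam lmax : ℝ} (hlmax : 0 < lmax)
    (hlen : ∀ e : E₁, Γ.len e ≤ lmax)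
    (hW : ∀ e : E₁, ∀ᵐ t ∂(edgeMeasure (Γ.len e)), -C ≤ W e t) :
    countingFunction (schroedinger B W E₁) lam ≤
      ((Fintype.card E₁ * (⌊Real.sqrt (lam + C) * lmax / Real.pi⌋₊ + 2) : ℕ) : ℕ∞) := by
  set m := ⌊Real.sqrt (lam + C) * lmax / Real.pi⌋₊ with hm
  have hlt : Real.sqrt (lam + C) < (m + 1) * Real.pi / lmax := by
    have h1 := Nat.lt_floor_add_one (Real.sqrt (lam + C) * lmax / Real.pi)
    rw [← hm, div_lt_iff₀ Real.pi_pos] at h1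
    rwa [lt_div_iff₀ hlmax]
  obtain ⟨κ, hκ1, hκ2⟩ := exists_between hlt
  have hκ0 : 0 < κ := (Real.sqrt_nonneg _).trans_lt hκ1
  refine countingFunction_le schroedinger_isFormalAdjoint fun M hM hle => ?_
  refine (rank_le_card_of_relation M (nodalRelation Γ E₁ m) ?_ ?_).trans (by simp)
  · intro x hx
    obtain ⟨f', f'', Hf⟩ := exists_isInGraph ⟨x, hM hx⟩
    obtain ⟨F, G, hF⟩ := Hf.exists_isRep
    exact ⟨fun p => F p.1 ((p.2 : ℕ) * Γ.len p.1 / (m + 1)), F,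
      fun e => ⟨(hF e).continuous_self, (hF e).ae_eq, fun _ => rfl⟩⟩
  · intro x hx h0
    refine eq_zero_of_nodal hκ0 ((Real.sqrt_lt' hκ0).1 hκ1) (fun e => ?_) hW ⟨x, hM hx⟩
      (hle ⟨x, hM hx⟩ hx) h0
    rw [lt_div_iff₀ hlmax] at hκ2
    exact (mul_le_mul_of_nonneg_left (hlen e) hκ0.le).trans_lt hκ2

end Weyl

/-! ### The number of edges in a ball -/

namespace MetricGraph

variable {E V : Type*} {Γ : MetricGraph E V}

/-- Each edge contributes at least $l_-$ to the volume. Finiteness of the volume therefore makes the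
edge set finite, and the growth bound limits its size. -/
lemma card_ballEdges_le {lmin lmax cp d : ℝ} (hl : Γ.EdgeLengthsIn lmin lmax)
    (hp : Γ.PolyGrowth lmin cp d) (v : V) {r : ℝ} (hr : lmin ≤ r) :
    ∃ _ : Fintype (Γ.ballEdges v r), (Fintype.card (Γ.ballEdges v r) : ℝ) ≤ cp * r ^ d / lmin := by
  obtain ⟨hl0, -, hl2⟩ := hl
  obtain ⟨h1, h2⟩ := hp v r hr
  have hfin : Finite (Γ.ballEdges v r) := by
    have h3 := ENNReal.finite_const_le_of_tsum_ne_top h1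
      (ε := ENNReal.ofReal lmin) (by simpa using hl0)
    have h4 : {e : Γ.ballEdges v r | ENNReal.ofReal lmin ≤ ENNReal.ofReal (Γ.len e)} = univ :=
      eq_univ_of_forall fun e => ENNReal.ofReal_le_ofReal (hl2 e).1
    rw [h4] at h3
    exact finite_univ_iff.1 h3
  refine ⟨Fintype.ofFinite _, ?_⟩
  let _ := Fintype.ofFinite (Γ.ballEdges v r)
  rw [le_div_iff₀ hl0]
  refine le_trans ?_ h2
  rw [vol, tsum_fintype, ENNReal.toReal_sum fun _ _ => ENNReal.ofReal_ne_top]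
  rw [← nsmul_eq_mul, ← Finset.card_univ]
  refine Finset.card_nsmul_le_sum _ _ _ fun e _ => ?_
  rw [ENNReal.toReal_ofReal (Γ.len_pos e).le]
  exact (hl2 e).1

end MetricGraph

/-! ### The bound for the random operator on a ball -/

namespace AlloyPotential

variable {E V : Type*} {Γ : MetricGraph E V} (A : AlloyPotential Γ)

lemma bound_nonneg : 0 ≤ A.bound :=
  mul_nonneg ((abs_nonneg _).trans (le_max_left _ _)) (A.cmin_pos.le.trans A.cmin_le)

lemma neg_bound_le_potential (ω : A.Config) (e : E) :
    ∀ᵐ t ∂(edgeMeasure (Γ.len e)), -A.bound ≤ A.potential ω e t := by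
  filter_upwards [A.bounds_ν e] with t ht
  have h1 : |(ω e : ℝ)| ≤ max |A.qmin| |A.qmax| := abs_le_max_abs_abs (ω e).2.1 (ω e).2.2
  have h2 : 0 ≤ A.ν e t := A.cmin_pos.le.trans ht.1
  refine (abs_le.1 ?_).1
  rw [potential, bound, abs_mul, abs_of_nonneg h2]
  exact mul_le_mul h1 ht.2 h2 ((abs_nonneg _).trans h1)

/-- The counting function of the restriction to a ball, in terms of the number of edges. -/
lemma countingFunction_ballOperator_le {lmin lmax cp d : ℝ} (hl : Γ.EdgeLengthsIn lmin lmax)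
    (hp : Γ.PolyGrowth lmin cp d) (B : VertexCondition Γ) (ω : A.Config) (v : V) {r : ℝ}
    (hr : lmin ≤ r) (lam : ℝ) :
    0 ≤ cp * r ^ d / lmin ∧
    (countingFunction (A.ballOperator B ω v r) lam : ℝ≥0∞) ≤
      ENNReal.ofReal ((2 + Real.sqrt (lam + A.bound) * lmax / Real.pi) * (cp * r ^ d / lmin)) := by
  obtain ⟨_, hcard⟩ := MetricGraph.card_ballEdges_le hl hp v hr
  have hlmax : 0 < lmax := hl.1.trans_le hl.2.1
  have h0 : 0 ≤ cp * r ^ d / lmin := (Nat.cast_nonneg _).trans hcard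
  refine ⟨h0, ?_⟩
  have h1 := countingFunction_schroedinger_le (B := B) (lam := lam) (W := A.potential ω)
    (E₁ := Γ.ballEdges v r) hlmax (fun e => (hl.2.2 e).2) fun e => A.neg_bound_le_potential ω e
  have h2 := ENat.toENNReal_le.2 h1
  refine h2.trans ?_
  rw [ENat.toENNReal_coe, ← ENNReal.ofReal_natCast]
  apply ENNReal.ofReal_le_ofReal
  have h3 : 0 ≤ Real.sqrt (lam + A.bound) * lmax / Real.pi := by positivity
  push_cast
  rw [mul_comm]
  refine mul_le_mul ?_ hcard (Nat.cast_nonneg _) (by linarith)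
  linarith [Nat.floor_le h3]

/-- Subadditivity of the square root separates the energy from $C_V$. The larger energy `lam'`
serves two purposes: it is `lam` itself in the pointwise bound, and an upper bound of the interval
in the uniform one. -/
lemma countingFunction_ballOperator_le_of_ge {lmin lmax cp d : ℝ} (hl : Γ.EdgeLengthsIn lmin lmax)
    (hp : Γ.PolyGrowth lmin cp d) (B : VertexCondition Γ) (ω : A.Config) (v : V) {r : ℝ}
    (hr : lmin ≤ r) {lam lam' : ℝ} (hlam : lam ≤ lam') :
    (countingFunction (A.ballOperator B ω v r) lam : ℝ≥0∞) ≤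
      ENNReal.ofReal ((2 + (Real.sqrt (max lam' 0) + Real.sqrt A.bound) * lmax / Real.pi) *
        (cp * r ^ d / lmin)) := by
  obtain ⟨h0, h1⟩ := A.countingFunction_ballOperator_le hl hp B ω v hr lam
  have hlmax : 0 < lmax := hl.1.trans_le hl.2.1
  refine h1.trans (ENNReal.ofReal_le_ofReal ?_)
  have h2 : Real.sqrt (lam + A.bound) ≤ Real.sqrt (max lam' 0) + Real.sqrt A.bound := by
    rw [Real.sqrt_le_left (by positivity), add_sq, Real.sq_sqrt (le_max_right _ _),
      Real.sq_sqrt A.bound_nonneg]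
    have h3 : 0 ≤ 2 * Real.sqrt (max lam' 0) * Real.sqrt A.bound := by positivity
    linarith [le_max_left lam' 0]
  have := Real.pi_pos
  gcongr

end AlloyPotential

end QGraph

theorem mainTheorem8 (lmin lmax CV cp : ℝ) :
    (∀ (E V : Type*) (Γ : QGraph.MetricGraph E V) (d : ℝ),
      Γ.EdgeLengthsIn lmin lmax → Γ.PolyGrowth lmin cp d →
      ∀ (B : QGraph.VertexCondition Γ) (A : QGraph.AlloyPotential Γ), A.bound = CV →
      ∀ (ω : A.Config) (v : V) (r : ℝ), lmin ≤ r → ∀ lam : ℝ,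
        (-CV ≤ lam →
          (QGraph.countingFunction (A.ballOperator B ω v r) lam : ℝ≥0∞) ≤
            ENNReal.ofReal ((2 + (Real.sqrt (max lam 0) + Real.sqrt CV) * lmax / Real.pi) *
              (cp * r ^ d / lmin))) ∧
        (lam < -CV →
          (QGraph.countingFunction (A.ballOperator B ω v r) lam : ℝ≥0∞) ≤
            ENNReal.ofReal (2 * cp * r ^ d / lmin))) ∧
    (∀ I : Set ℝ, I.OrdConnected → Bornology.IsBounded I →
      ∃ CWeyl : ℝ, ∀ (E V : Type*) (Γ : QGraph.MetricGraph E V) (d : ℝ),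
        Γ.EdgeLengthsIn lmin lmax → Γ.PolyGrowth lmin cp d →
        ∀ (B : QGraph.VertexCondition Γ) (A : QGraph.AlloyPotential Γ), A.bound = CV →
        ∀ (ω : A.Config) (v : V) (r : ℝ), lmin ≤ r → ∀ lam ∈ I,
          (QGraph.countingFunction (A.ballOperator B ω v r) lam : ℝ≥0∞) ≤
            ENNReal.ofReal (CWeyl * r ^ d)) := by
  refine ⟨fun E V Γ d hl hp B A hA ω v r hr lam => ⟨fun _ => ?_, fun hlam => ?_⟩,
    fun I _ hI => ?_⟩
  · rw [← hA]
    exact A.countingFunction_ballOperator_le_of_ge hl hp B ω v hr le_rfl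
  · have h := (A.countingFunction_ballOperator_le hl hp B ω v hr lam).2
    -- Below $-C_V$ the argument of the root is negative and only the 2 remains.
    rw [Real.sqrt_eq_zero_of_nonpos (by linarith)] at h
    refine h.trans (le_of_eq ?_)
    congr 1
    ring
  · obtain ⟨b, hb⟩ := hI.bddAbove
    -- The constant is the first bound at an upper bound `b` of the interval, with $r^d$ split off;
    -- it is fixed before the graph, the degree and the potential.
    refine ⟨(2 + (Real.sqrt (max b 0) + Real.sqrt CV) * lmax / Real.pi) * (cp / lmin), ?_⟩
    intro E V Γ d hl hp B A hA ω v r hr lam hlam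
    subst hA
    refine (A.countingFunction_ballOperator_le_of_ge hl hp B ω v hr (hb hlam)).trans (le_of_eq ?_)
    congr 1
    ring
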